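/- Theorem 1. Let $d\ge 1$, $K$ be positive integers and $\delta\in(0,e^{-1}]$, and let $\theta^*\in\mathbb R^d$ with $\|\theta^*\|_2\le 1$ be unknown. In each round $k=1,\dots,K$ a learner observes an arm set $\mathcal X_k\subseteq\{x\in\mathbb R^d:\|x\|_2\le 1\}$, plays $x_k\in\mathcal X_k$, and receives the reward $r_k=x_k^\top\theta^*+\epsilon_k$. Assume that $|r_k|\le 1$ almost surely and that, with $\mathcal F_k=\sigma(x_1,\epsilon_1,\dots,x_{k-1},\epsilon_{k-1},x_k)$, $\mathbb E[\epsilon_k\mid\mathcal F_k]=0$ and $\mathbb E[\epsilon_k^2\mid\mathcal F_k]=\sigma_k^2$; the $\sigma_k^2$ are not known to the learner and may be random. Put $L=1\vee\lfloor\log_2(1+K/d)\rfloor$ and $\iota=128\ln\big((12K2^L)^{d+2}/\delta\big)$, let $(z)_\ell=\min\{|z|,2^{-\ell}\}\,z/|z|$ (with $0/0=0$), and for $0\le k\le K$ let $\Theta_k$ be the set of all $\theta$ with $\|\theta\|_2\le 1$ such that for all $\ell\in\{1,\dots,L\}$ and all $\mu\in\mathbb R^d$ with $\|\mu\|_2\le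 2$ $$\Big|\sum_{s=1}^k (x_s^\top\mu)_\ell\,(r_s-x_s^\top\theta)\Big|\le\sqrt{\sum_{s=1}^k (x_s^\top\mu)_\ell^2\,(r_s-x_s^\top\theta)^2\,\iota}+2^{-\ell}\iota .$$ (So $\Theta_0$ is the unit ball.) The algorithm VOFUL2 plays in round $k$ an arm $x_k\in\arg\max_{x\in\mathcal X_k}\max_{\theta\in\Theta_0\cap\dots\cap\Theta_{k-1}}x^\top\theta$ (the maximum is assumed to be attained; the choice is arbitrary if the intersection is empty). There are absolute constants $C>0$ and $p\in\mathbb N$ such that, in every such problem, the regret $\mathcal R^K=\sum_{k=1}^K\big(\sup_{x\in\mathcal X_k}x^\top\theta^*-x_k^\top\theta^*\big)$ of VOFUL2 satisfies, with probability at least $1-2\delta$, $$\mathcal R^K\le C\,\ln^p\!\Big(e+d+K+\sum_{k=1}^K\sigma_k^2+\ln\tfrac1\delta\Big)\Big(d^{1.5}\sqrt{\textstyle\sum_{k=1}^K\sigma_k^2\,\ln(1/\delta)}+d^2\ln(1/\delta)\Big).$$ -/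

import Mathlib

open MeasureTheory

noncomputable section

/-- `d`-dimensional Euclidean space, with the `ℓ₂` norm. -/
abbrev Vec (d : ℕ) : Type := EuclideanSpace ℝ (Fin d)

/-- The clipping operator `min {|z|, 2^{-ℓ}} · z / |z|`, with `0 / 0 = 0`. -/
def clip (ℓ : ℕ) (z : ℝ) : ℝ := min |z| ((2 : ℝ) ^ (-(ℓ : ℤ))) * (z / |z|)

/-- The number of levels, `L = 1 ∨ ⌊log₂ (1 + K / d)⌋`. -/
def numLevels (d K : ℕ) : ℕ := max 1 ⌊Real.logb 2 (1 + (K : ℝ) / (d : ℝ))⌋₊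

/-- The confidence width `ι = 128 ln ((12 K 2^L)^{d+2} / δ)`. -/
def iota (d K : ℕ) (δ : ℝ) : ℝ :=
  128 * Real.log ((12 * (K : ℝ) * 2 ^ numLevels d K) ^ (d + 2) / δ)

/-- The residual `ε_s(θ) = y_s - x_sᵀ θ`. -/
def noiseResidual {d : ℕ} (x : ℕ → Vec d) (y : ℕ → ℝ) (s : ℕ) (θ : Vec d) : ℝ :=
  y s - inner ℝ (x s) θ

/-- The level-`ℓ` confidence set computed from the first `n` rounds. Rounds are numbered from `0`,
so these are the rounds `s < n`. -/
def confLevel {d : ℕ} (K : ℕ) (δ : ℝ) (x : ℕ → Vec d) (y : ℕ → ℝ) (n ℓ : ℕ) : Set (Vec d) :=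
  {θ | ‖θ‖ ≤ 1 ∧ ∀ μ : Vec d, ‖μ‖ ≤ 2 →
    |∑ s ∈ Finset.range n, clip ℓ (inner ℝ (x s) μ) * noiseResidual x y s θ| ≤
      √((∑ s ∈ Finset.range n,
          clip ℓ (inner ℝ (x s) μ) ^ 2 * noiseResidual x y s θ ^ 2) * iota d K δ)
        + (2 : ℝ) ^ (-(ℓ : ℤ)) * iota d K δ}

/-- The confidence set after `n` rounds: the intersection over the levels `1 ≤ ℓ ≤ L`. -/
def confSet {d : ℕ} (K : ℕ) (δ : ℝ) (x : ℕ → Vec d) (y : ℕ → ℝ) (n : ℕ) : Set (Vec d) :=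
  {θ | ∀ ℓ ∈ Finset.Icc 1 (numLevels d K), θ ∈ confLevel K δ x y n ℓ}

/-- The set over which round `k` (numbered from `0`, hence with `k` completed rounds) is optimistic:
the intersection of the confidence sets after `n ≤ k` rounds. The one with `n = 0` is the unit ball,
so that is the set used in the very first round. -/
def optimisticSet {d : ℕ} (K : ℕ) (δ : ℝ) (x : ℕ → Vec d) (y : ℕ → ℝ) (k : ℕ) : Set (Vec d) :=
  {θ | ∀ n ≤ k, θ ∈ confSet K δ x y n}

/-- The arm `x k` is a choice of VOFUL2 in round `k` from the arm set `A`, after the data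
`x s, y s` with `s < k`: it is an arm of `A` which, for some `θ` in the optimistic set, attains
`max_{z ∈ A} max_{θ ∈ optimisticSet} zᵀ θ`. If the optimistic set is empty, so that there is nothing
to maximize, any arm of `A` may be played. -/
def IsVOFUL2Choice {d : ℕ} (K : ℕ) (δ : ℝ) (A : Set (Vec d)) (x : ℕ → Vec d) (y : ℕ → ℝ)
    (k : ℕ) : Prop :=
  x k ∈ A ∧
    ((optimisticSet K δ x y k).Nonempty →
      ∃ θ ∈ optimisticSet K δ x y k, ∀ z ∈ A, ∀ θ' ∈ optimisticSet K δ x y k,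
        inner ℝ z θ' ≤ inner ℝ (x k) θ)

/-- The `σ`-algebra generated by `x_s, ε_s` for `s < k` and by `x_k`. -/
@[reducible] def history {d : ℕ} {Ω : Type*} (x : ℕ → Ω → Vec d) (ε : ℕ → Ω → ℝ) (k : ℕ) :
    MeasurableSpace Ω :=
  (⨆ s ∈ Finset.range k,
      (MeasurableSpace.comap (x s) inferInstance ⊔ MeasurableSpace.comap (ε s) inferInstance))
    ⊔ MeasurableSpace.comap (x k) inferInstance

/-- The regret over `K` rounds of playing `x k` from the arm sets `A k` when the parameter
is `θstar`. -/
def regret {d : ℕ} (K : ℕ) (θstar : Vec d) (A : ℕ → Set (Vec d)) (x : ℕ → Vec d) : ℝ :=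
  ∑ k ∈ Finset.range K, (sSup ((fun z : Vec d => inner ℝ z θstar) '' A k) - inner ℝ (x k) θstar)

end

/-!
Write `μ k = θ k - θstar` for the optimistic parameter `θ k` of round `k`. Optimism bounds the
regret of round `k` by `⟪x k, μ k⟫`, provided that `θstar` lies in all confidence sets.

*Validity.* For a martingale increment `Y` with `|Y| ≤ 1/2` one has `exp (Y - Y²) ≤ 1 + Y`, so
`exp (∑ (t X - t² X²))` has mean at most one for `X = clip ⟪x, μ⟫ * ε` and small `t`
(`measure_selfNormalized_sum_le`). A union bound over a net of directions, the levels, a dyadic grid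
of `t`, the times and the signs gives the self-normalized inequalities defining the confidence sets,
outside an event of probability `δ` (`measure_exists_selfNormalized_gt_le`, `mem_confSet_of_net`).
Outside another such event the realized variation `∑ ε²` is at most a multiple of
`∑ σ² + log (1 / δ)` (`measure_sum_sq_noise_gt_le`).

*Regret.* Since `θ k` and `θstar` both lie in the level-`ℓ` confidence set, the truncated quadratic
energy `∑_{s < k} clip ⟪x s, μ k⟫ * ⟪x s, μ k⟫` is at most `2 ^ (-ℓ) * B`, with
`B = 5 √(ι ∑ ε²) + 8 ι` (`sum_clip_mul_le_of_mem_confLevel`). Rounds are peeled according to the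
dyadic size of `⟪x k, μ k⟫`, and it remains to see that `⟪x k, μ k⟫ > 2 ^ (-ℓ)` happens in at most
about `d * 2 ^ ℓ * B` rounds. This is `card_le_of_truncated_energy_le`, an elliptical potential
count for an energy that is quadratic only near `0`. The potential is `∫ exp (-V)`, where `V` is
the energy divided by its bound `M` (with a pseudo-Huber function in place of the truncated square)
plus a small multiple of `‖ν‖²`; for a quadratic `V` it is, up to a constant, the inverse square
root of a determinant. The symmetric second difference `V (ν + b) + V (ν - b) - 2 V ν` is bounded by
the truncated energy of `b`, uniformly in `ν`, so by translating by `±b` one sees that a fixed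
fraction of the mass of `exp (-V)` has `|⟪x k, ν⟫| ≥ 1/2`. Each counted round therefore shrinks the
potential by the factor `exp (-1 / (162 M))` (`integral_exp_neg_add_le`), while Gaussian integrals
bound it from both sides.

Weighted by the gap `2 ^ (-ℓ)`, each of the `L` levels contributes `d * B` up to logarithms. As `ι`
is of order `d` up to logarithms, `d * √(ι ∑ ε²)` is the `d ^ (3/2)` term and `d * ι` the `d ^ 2`
term.
-/

/-! ### A potential-counting lemma for truncated quadratics -/

/-- The pseudo-Huber function `√(1 + z²) - 1`, a smooth substitute for `min |z| 1 * |z|`: it is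
quadratic near `0` and linear at infinity. -/
noncomputable def pseudoHuber (z : ℝ) : ℝ := √(1 + z ^ 2) - 1

lemma continuous_pseudoHuber : Continuous pseudoHuber := by
  unfold pseudoHuber; fun_prop

lemma pseudoHuber_nonneg (z : ℝ) : 0 ≤ pseudoHuber z := by
  have : (1 : ℝ) ≤ √(1 + z ^ 2) := Real.one_le_sqrt.2 (by nlinarith [sq_nonneg z])
  unfold pseudoHuber; linarith

lemma pseudoHuber_le_half_sq (z : ℝ) : pseudoHuber z ≤ z ^ 2 / 2 := by
  have : √(1 + z ^ 2) ≤ 1 + z ^ 2 / 2 :=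
    Real.sqrt_le_iff.2 ⟨by positivity, by nlinarith [sq_nonneg (z ^ 2)]⟩
  unfold pseudoHuber; linarith

lemma le_pseudoHuber_of_half_le_abs {z : ℝ} (hz : 1 / 2 ≤ |z|) : 1 / 9 ≤ pseudoHuber z := by
  have h1 : (1 / 4 : ℝ) ≤ z ^ 2 := by rw [← sq_abs]; nlinarith
  have : (10 / 9 : ℝ) ≤ √(1 + z ^ 2) := Real.le_sqrt_of_sq_le (by nlinarith)
  unfold pseudoHuber; linarith

/-- The symmetric second difference of the pseudo-Huber function is controlled, uniformly in the
base point, by the truncated quadratic of the increment. -/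
lemma pseudoHuber_second_difference_le (a b : ℝ) :
    pseudoHuber (a + b) + pseudoHuber (a - b) ≤ 2 * pseudoHuber a + 2 * (min |b| 1 * |b|) := by
  unfold pseudoHuber
  have hu0 : (1 : ℝ) ≤ √(1 + a ^ 2) := Real.one_le_sqrt.2 (by nlinarith [sq_nonneg a])
  have hu2 : √(1 + a ^ 2) ^ 2 = 1 + a ^ 2 := Real.sq_sqrt (by positivity)
  have hau : |a| ≤ √(1 + a ^ 2) := Real.abs_le_sqrt (by linarith)
  set u := √(1 + a ^ 2)
  rcases le_total |b| 1 with hb | hb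
  · rw [min_eq_left hb]
    have key : ∀ c : ℝ, √(1 + (a + c) ^ 2) ≤ u + (2 * a * c + c ^ 2) / (2 * u) := by
      intro c
      have hpos : 0 ≤ u + (2 * a * c + c ^ 2) / (2 * u) := by
        have : u + (2 * a * c + c ^ 2) / (2 * u) = (u ^ 2 + 1 + (a + c) ^ 2) / (2 * u) := by
          field_simp; linarith
        rw [this]; positivity
      refine Real.sqrt_le_iff.2 ⟨hpos, ?_⟩
      have : (u + (2 * a * c + c ^ 2) / (2 * u)) ^ 2
          = u ^ 2 + (2 * a * c + c ^ 2) + ((2 * a * c + c ^ 2) / (2 * u)) ^ 2 := by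
        field_simp; ring
      rw [this, hu2]
      nlinarith [sq_nonneg ((2 * a * c + c ^ 2) / (2 * u))]
    have h1 := key b
    have h2 := key (-b)
    have h3 : (2 * a * b + b ^ 2) / (2 * u) + (2 * a * -b + (-b) ^ 2) / (2 * u) = b ^ 2 / u := by
      field_simp; ring
    have h4 : b ^ 2 / u ≤ b ^ 2 := div_le_self (sq_nonneg b) hu0
    rw [← sub_eq_add_neg] at h2
    have h5 : |b| * |b| = b ^ 2 := by rw [← sq, sq_abs]
    rw [h5]
    nlinarith [sq_nonneg b]
  · rw [min_eq_right hb]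
    have key : ∀ c : ℝ, √(1 + (a + c) ^ 2) ≤ u + |c| := by
      intro c
      refine Real.sqrt_le_iff.2 ⟨by positivity, ?_⟩
      have : a * c ≤ u * |c| := by
        calc a * c ≤ |a * c| := le_abs_self _
          _ = |a| * |c| := abs_mul _ _
          _ ≤ _ := by gcongr
      nlinarith [sq_abs c]
    have h1 := key b
    have h2 := key (-b)
    rw [← sub_eq_add_neg, abs_neg] at h2
    linarith

lemma exp_neg_le_one_sub_half {y : ℝ} (h0 : 0 ≤ y) (h1 : y ≤ 1) :
    Real.exp (-y) ≤ 1 - y / 2 := by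
  have h := Real.add_one_le_exp y
  rw [Real.exp_neg, inv_le_comm₀ (Real.exp_pos y) (by linarith)]
  refine le_trans ?_ h
  rw [inv_le_iff_one_le_mul₀ (by linarith)]
  nlinarith

section Count

variable {d : ℕ}

/-- One step of the counting argument. If translating by `±b` raises the energy `V` by at most `2`
on average, and `u` separates `b` from `0`, then a fixed fraction of the mass of `exp (-V)` lies in
`1/2 ≤ |⟪u, ν⟫|`, where adding `β * pseudoHuber ⟪u, ν⟫` to the energy costs a factor. -/
lemma integral_exp_neg_add_le {V : Vec d → ℝ} (hV : Continuous V)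
    (hint : Integrable fun ν => Real.exp (-V ν)) {b u : Vec d}
    (hb : ∀ ν, V (ν + b) + V (ν - b) ≤ 2 * V ν + 4) (hub : 1 < inner ℝ u b)
    {β : ℝ} (hβ0 : 0 ≤ β) (hβ1 : β ≤ 1) :
    ∫ ν, Real.exp (-(V ν + β * pseudoHuber (inner ℝ u ν)))
      ≤ Real.exp (-(β / 162)) * ∫ ν, Real.exp (-V ν) := by
  set I : Set (Vec d) := {ν | |inner ℝ u ν| < 1 / 2} with hI
  have hIm : MeasurableSet I := (isOpen_lt (by fun_prop) (by fun_prop)).measurableSet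
  set g : Vec d → ℝ := fun ν => Real.exp (-V ν) with hg
  have hg0 : ∀ ν, 0 ≤ g ν := fun ν => (Real.exp_pos _).le
  have hsplit : (∫ ν in I, g ν) + ∫ ν in Iᶜ, g ν = ∫ ν, g ν := integral_add_compl hIm hint
  set a := ∫ ν in I, g ν with ha
  set o := ∫ ν in Iᶜ, g ν with ho
  have ha0 : 0 ≤ a := integral_nonneg hg0
  -- The translates of the slab by `±b` miss the slab.
  have hshift : ∀ c : Vec d, 1 < |inner ℝ u c| → ∫ ν in I, g (ν + c) ≤ o := by
    intro c hc
    rw [ho, ← integral_indicator hIm, ← integral_indicator hIm.compl,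
      ← integral_add_right_eq_self (fun ν => Iᶜ.indicator g ν) c]
    refine integral_mono ?_ ?_ ?_
    · exact (hint.comp_add_right c).indicator hIm
    · exact (hint.indicator hIm.compl).comp_add_right c
    · intro ν
      by_cases hν : ν ∈ I
      · have : ν + c ∈ Iᶜ := by
          simp only [hI, Set.mem_compl_iff, Set.mem_ofPred_eq, not_lt] at hν ⊢
          rw [inner_add_right]
          have := abs_sub_abs_le_abs_sub (inner ℝ u c : ℝ) (-inner ℝ u ν)
          rw [abs_neg, sub_neg_eq_add, add_comm (inner ℝ u c : ℝ)] at this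
          linarith
        simp [Set.indicator_of_mem hν, Set.indicator_of_mem this]
      · simp only [Set.indicator_of_notMem hν]
        exact Set.indicator_nonneg (fun x _ => hg0 x) _
  have hao : Real.exp (-2) * a ≤ o := by
    have h1 := hshift b (hub.trans_le (le_abs_self _))
    have h2 := hshift (-b) (by rw [inner_neg_right, abs_neg]; exact hub.trans_le (le_abs_self _))
    have h3 : Real.exp (-2) * a
        ≤ ∫ ν in I, (1 / 2 * g (ν + b) + 1 / 2 * g (ν + -b)) := by
      rw [ha, ← integral_const_mul]
      refine integral_mono (hint.integrableOn.const_mul _) ?_ ?_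
      · exact ((hint.comp_add_right b).integrableOn.const_mul _).add
          ((hint.comp_add_right (-b)).integrableOn.const_mul _)
      · intro ν
        have h := hb ν
        rw [sub_eq_add_neg] at h
        simp only [hg, ← Real.exp_add]
        -- The arithmetic-geometric mean inequality for the two translates.
        set p := Real.exp (-V (ν + b) / 2) with hp
        set q := Real.exp (-V (ν + -b) / 2) with hq
        have e1 : Real.exp (-V (ν + b)) = p ^ 2 := by
          rw [hp, ← Real.exp_nat_mul]; congr 1; push_cast; ring
        have e2 : Real.exp (-V (ν + -b)) = q ^ 2 := by
          rw [hq, ← Real.exp_nat_mul]; congr 1; push_cast; ring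
        have e3 : Real.exp (-2 + -V ν) ≤ p * q := by
          rw [hp, hq, ← Real.exp_add]
          exact Real.exp_le_exp.2 (by linarith)
        rw [e1, e2]
        nlinarith [sq_nonneg (p - q)]
    rw [integral_add ((hint.comp_add_right b).integrableOn.const_mul _)
      ((hint.comp_add_right (-b)).integrableOn.const_mul _), integral_const_mul,
      integral_const_mul] at h3
    linarith
  -- As `exp (-2) ≥ 1/8`, at least `1/9` of the mass lies outside the slab.
  have hexp2 : (1 / 8 : ℝ) ≤ Real.exp (-2) := by
    rw [Real.exp_neg, one_div]
    refine inv_anti₀ (Real.exp_pos _) ?_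
    have h : Real.exp 2 = Real.exp 1 ^ 2 := by rw [← Real.exp_nat_mul]; norm_num
    rw [h]
    nlinarith [Real.exp_one_lt_d9, Real.exp_pos 1]
  have ho' : (a + o) / 9 ≤ o := by nlinarith
  set g' : Vec d → ℝ := fun ν => Real.exp (-(V ν + β * pseudoHuber (inner ℝ u ν))) with hg'
  have hle : ∀ ν, g' ν ≤ g ν := fun ν => by
    refine Real.exp_le_exp.2 ?_
    have := mul_nonneg hβ0 (pseudoHuber_nonneg (inner ℝ u ν))
    linarith
  have hint' : Integrable g' := by
    refine hint.mono' ?_ (ae_of_all _ fun ν => ?_)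
    · have := continuous_pseudoHuber
      exact Continuous.aestronglyMeasurable (by fun_prop)
    · rw [Real.norm_of_nonneg (Real.exp_pos _).le]; exact hle ν
  have hI' : ∫ ν in I, g' ν ≤ a := setIntegral_mono hint'.integrableOn hint.integrableOn hle
  have hO' : ∫ ν in Iᶜ, g' ν ≤ (1 - β / 18) * o := by
    rw [ho, ← integral_const_mul]
    refine setIntegral_mono_on hint'.integrableOn (hint.integrableOn.const_mul _) hIm.compl ?_
    intro ν hν
    simp only [hI, Set.mem_compl_iff, Set.mem_ofPred_eq, not_lt] at hν
    have h1 := le_pseudoHuber_of_half_le_abs hν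
    have h2 : Real.exp (-(β / 9)) ≤ 1 - β / 9 / 2 :=
      exp_neg_le_one_sub_half (by positivity) (by linarith)
    calc g' ν ≤ Real.exp (-(β / 9)) * g ν := by
          simp only [hg', hg, ← Real.exp_add]
          refine Real.exp_le_exp.2 ?_
          nlinarith
      _ ≤ (1 - β / 18) * g ν := by
          refine mul_le_mul_of_nonneg_right (by linarith) (hg0 ν)
  have hsplit' : (∫ ν in I, g' ν) + ∫ ν in Iᶜ, g' ν = ∫ ν, g' ν := integral_add_compl hIm hint'
  have hfin := Real.add_one_le_exp (-(β / 162))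
  rw [← hsplit', ← hsplit]
  calc _ ≤ a + (1 - β / 18) * o := add_le_add hI' hO'
    _ ≤ (-(β / 162) + 1) * (a + o) := by nlinarith
    _ ≤ _ := by
      refine mul_le_mul_of_nonneg_right hfin ?_
      nlinarith

lemma integral_exp_neg_mul_norm_sq {c : ℝ} (hc : 0 < c) :
    ∫ v : Vec d, Real.exp (-(c * ‖v‖ ^ 2)) = (Real.pi / c) ^ (d / 2 : ℝ) := by
  have h := GaussianFourier.integral_rexp_neg_mul_sq_norm (V := Vec d) hc
  rw [finrank_euclideanSpace_fin] at h
  rw [← h]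
  simp only [neg_mul]

/-- Counting lemma. If on a set `G` of rounds the vector `ν k` is seen by `x k` (`⟪x k, ν k⟫ > 1`)
although its truncated quadratic energy against the previous rounds is at most `M`, then `G` has at
most about `d * M` elements. For the plain quadratic energy this is the elliptical potential
count; here the determinant is replaced by the integral of `exp (-energy)`. -/
lemma card_le_of_truncated_energy_le (K : ℕ) (G : Finset ℕ) (hG : G ⊆ Finset.range K)
    (x ν : ℕ → Vec d) {M R : ℝ} (hM : 1 ≤ M) (hR : 0 < R)
    (hx : ∀ k < K, ‖x k‖ ≤ 1) (hν : ∀ k ∈ G, ‖ν k‖ ≤ R)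
    (hxν : ∀ k ∈ G, 1 < inner ℝ (x k) (ν k))
    (hE : ∀ k ∈ G, ∑ s ∈ Finset.range k,
      min |inner ℝ (x s) (ν k)| 1 * |inner ℝ (x s) (ν k)| ≤ M) :
    (G.card : ℝ) ≤ 81 * d * M * Real.log (1 + K * R ^ 2) := by
  have hM0 : 0 < M := by linarith
  set β : ℝ := 1 / M with hβ
  have hβ0 : 0 < β := by positivity
  have hβ1 : β ≤ 1 := by rw [hβ, div_le_one hM0]; exact hM
  -- With these weights the energy of each `ν k`, `k ∈ G`, is at most `2`.
  set ρ : ℝ := 1 / R ^ 2 with hρ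
  have hρ0 : 0 < ρ := by positivity
  set V : ℕ → Vec d → ℝ := fun k v =>
    ρ * ‖v‖ ^ 2 + ∑ s ∈ Finset.range k with s ∈ G, β * pseudoHuber (inner ℝ (x s) v) with hVdef
  have hVc : ∀ k, Continuous (V k) := by
    intro k
    have := continuous_pseudoHuber
    fun_prop
  have hgauss : ∀ c : ℝ, 0 < c → Integrable fun v : Vec d => Real.exp (-(c * ‖v‖ ^ 2)) := by
    intro c hc
    have h := integral_exp_neg_mul_norm_sq hc (d := d)
    refine Integrable.of_integral_ne_zero ?_
    rw [h]
    have := Real.pi_pos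
    positivity
  have hVint : ∀ k, Integrable fun v => Real.exp (-V k v) := by
    intro k
    refine (hgauss ρ hρ0).mono' (Continuous.aestronglyMeasurable (by have := hVc k; fun_prop))
      (ae_of_all _ fun v => ?_)
    rw [Real.norm_of_nonneg (Real.exp_pos _).le]
    refine Real.exp_le_exp.2 (neg_le_neg ?_)
    exact le_add_of_nonneg_right
      (Finset.sum_nonneg fun s _ => mul_nonneg hβ0.le (pseudoHuber_nonneg _))
  have hstep : ∀ k ≤ K, ∫ v, Real.exp (-V k v)
      ≤ Real.exp (-(((Finset.range k).filter (· ∈ G)).card * (β / 162)))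
        * ∫ v, Real.exp (-V 0 v) := by
    intro k
    induction k with
    | zero => intro _; simp
    | succ k ih =>
      intro hk
      have ih := ih (by omega)
      by_cases hkG : k ∈ G
      · have hb : ∀ v, V k (v + ν k) + V k (v - ν k) ≤ 2 * V k v + 4 := by
          intro v
          have h1 : ρ * ‖v + ν k‖ ^ 2 + ρ * ‖v - ν k‖ ^ 2 ≤ 2 * (ρ * ‖v‖ ^ 2) + 2 := by
            have := parallelogram_law_with_norm ℝ v (ν k)
            have h2 : ρ * ‖ν k‖ ^ 2 ≤ 1 := by
              rw [hρ, one_div, inv_mul_le_iff₀ (by positivity), mul_one]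
              have := hν k hkG
              gcongr
            nlinarith
          have h2 : ∑ s ∈ Finset.range k with s ∈ G, β * pseudoHuber (inner ℝ (x s) (v + ν k))
              + ∑ s ∈ Finset.range k with s ∈ G, β * pseudoHuber (inner ℝ (x s) (v - ν k))
              ≤ 2 * ∑ s ∈ Finset.range k with s ∈ G, β * pseudoHuber (inner ℝ (x s) v) + 2 := by
            have h3 : ∑ s ∈ Finset.range k with s ∈ G,
                min |inner ℝ (x s) (ν k)| 1 * |inner ℝ (x s) (ν k)| ≤ M :=
              (Finset.sum_le_sum_of_subset_of_nonneg (Finset.filter_subset _ _)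
                fun s _ _ => by positivity).trans (hE k hkG)
            have h4 : β * ∑ s ∈ Finset.range k with s ∈ G,
                min |inner ℝ (x s) (ν k)| 1 * |inner ℝ (x s) (ν k)| ≤ 1 := by
              rw [hβ, one_div, inv_mul_le_iff₀ hM0]; linarith
            rw [← Finset.sum_add_distrib]
            calc _ ≤ ∑ s ∈ Finset.range k with s ∈ G,
                  (2 * (β * pseudoHuber (inner ℝ (x s) v)) +
                    2 * (β * (min |inner ℝ (x s) (ν k)| 1 * |inner ℝ (x s) (ν k)|))) := by
                  refine Finset.sum_le_sum fun s _ => ?_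
                  rw [inner_add_right, inner_sub_right]
                  have := pseudoHuber_second_difference_le (inner ℝ (x s) v)
                    (inner ℝ (x s) (ν k))
                  nlinarith
              _ = 2 * ∑ s ∈ Finset.range k with s ∈ G, β * pseudoHuber (inner ℝ (x s) v)
                  + 2 * (β * ∑ s ∈ Finset.range k with s ∈ G,
                    min |inner ℝ (x s) (ν k)| 1 * |inner ℝ (x s) (ν k)|) := by
                  rw [Finset.sum_add_distrib, Finset.mul_sum, Finset.mul_sum, Finset.mul_sum]
              _ ≤ _ := by linarith
          simp only [hVdef]
          linarith
        have hs := integral_exp_neg_add_le (hVc k) (hVint k) hb (hxν k hkG) hβ0.le hβ1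
        have hVs : ∀ v, V (k + 1) v = V k v + β * pseudoHuber (inner ℝ (x k) v) := by
          intro v
          simp only [hVdef, Finset.range_add_one, Finset.filter_insert, hkG, if_true]
          rw [Finset.sum_insert (by simp)]; ring
        have hc : ((Finset.range (k + 1)).filter (· ∈ G)).card
            = ((Finset.range k).filter (· ∈ G)).card + 1 := by
          rw [Finset.range_add_one, Finset.filter_insert, if_pos hkG,
            Finset.card_insert_of_notMem (by simp)]
        simp only [hVs]
        refine hs.trans ?_
        rw [hc]
        refine (mul_le_mul_of_nonneg_left ih (Real.exp_pos _).le).trans (le_of_eq ?_)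
        rw [← mul_assoc, ← Real.exp_add]
        congr 2
        push_cast; ring
      · have hf : (Finset.range (k + 1)).filter (· ∈ G) = (Finset.range k).filter (· ∈ G) := by
          rw [Finset.range_add_one, Finset.filter_insert, if_neg hkG]
        simp only [hVdef, hf] at ih ⊢
        exact ih
  have hK := hstep K le_rfl
  have hGf : (Finset.range K).filter (· ∈ G) = G := by
    ext s; simp only [Finset.mem_filter]; exact ⟨fun h => h.2, fun h => ⟨hG h, h⟩⟩
  rw [hGf] at hK
  have hlow : (Real.pi / (ρ + K)) ^ (d / 2 : ℝ) ≤ ∫ v, Real.exp (-V K v) := by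
    rw [← integral_exp_neg_mul_norm_sq (by positivity)]
    refine integral_mono (hgauss _ (by positivity)) (hVint K) fun v => ?_
    refine Real.exp_le_exp.2 (neg_le_neg ?_)
    have : ∑ s ∈ Finset.range K with s ∈ G, β * pseudoHuber (inner ℝ (x s) v)
        ≤ K * ‖v‖ ^ 2 := by
      rw [hGf]
      calc _ ≤ ∑ s ∈ G, ‖v‖ ^ 2 := by
            refine Finset.sum_le_sum fun s hs => ?_
            have h1 := pseudoHuber_le_half_sq (inner ℝ (x s) v)
            have h2 := pseudoHuber_nonneg (inner ℝ (x s) v)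
            have h3 : |inner ℝ (x s) v| ≤ ‖v‖ :=
              (abs_real_inner_le_norm _ _).trans
                (mul_le_of_le_one_left (norm_nonneg _) (hx s (Finset.mem_range.1 (hG hs))))
            have h4 : (inner ℝ (x s) v : ℝ) ^ 2 ≤ ‖v‖ ^ 2 := by
              rw [← sq_abs]; gcongr
            nlinarith [sq_nonneg (inner ℝ (x s) v : ℝ)]
        _ = G.card * ‖v‖ ^ 2 := by simp
        _ ≤ K * ‖v‖ ^ 2 := by
            have : (G.card : ℝ) ≤ K := by exact_mod_cast (Finset.card_le_card hG).trans (by simp)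
            gcongr
    simp only [hVdef]
    linarith
  have hup : ∫ v, Real.exp (-V 0 v) = (Real.pi / ρ) ^ (d / 2 : ℝ) := by
    rw [← integral_exp_neg_mul_norm_sq hρ0]
    simp [hVdef]
  rw [hup] at hK
  have h1 := hlow.trans hK
  have hpi := Real.pi_pos
  have h2 := Real.log_le_log (by positivity) h1
  rw [Real.log_mul (by positivity) (by positivity), Real.log_exp, Real.log_rpow (by positivity),
    Real.log_rpow (by positivity), Real.log_div (by positivity) (by positivity),
    Real.log_div (by positivity) (by positivity)] at h2
  have h3 : Real.log (ρ + K) = Real.log ρ + Real.log (1 + K * R ^ 2) := by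
    rw [← Real.log_mul (by positivity) (by positivity)]
    congr 1
    rw [hρ]; field_simp
  rw [h3] at h2
  have h4 : G.card * (β / 162) ≤ d / 2 * Real.log (1 + K * R ^ 2) := by nlinarith
  calc (G.card : ℝ) = G.card * (β / 162) * (162 * M) := by rw [hβ]; field_simp
    _ ≤ d / 2 * Real.log (1 + K * R ^ 2) * (162 * M) := by gcongr
    _ = _ := by ring

end Count

/-! ### A finite net of the ball of radius two -/

section Net

variable {d : ℕ}

/-- Volume bound on separated subsets of the ball of radius `2`: the balls of radius `η / 2` around
the points are disjoint and lie in the ball of radius `2 + η / 2`. -/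
lemma card_le_of_separated_ball_two {η : ℝ} (hη : 0 < η) (s : Finset (Vec d))
    (hs : ∀ c ∈ s, ‖c‖ ≤ 2) (h : ∀ c ∈ s, ∀ c' ∈ s, c ≠ c' → η ≤ ‖c - c'‖) :
    (s.card : ℝ) ≤ (1 + 4 / η) ^ d := by
  let μ : Measure (Vec d) := Measure.addHaar
  set r : ℝ := η / 2 with hr
  set ρ : ℝ := 2 + η / 2 with hρ
  have rpos : 0 < r := by positivity
  have ρpos : 0 < ρ := by positivity
  set A := ⋃ c ∈ s, Metric.ball (c : Vec d) r with hA
  have D : Set.Pairwise (s : Set (Vec d)) (Function.onFun Disjoint fun c => Metric.ball c r) := by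
    rintro c hc c' hc' hcc
    apply Metric.ball_disjoint_ball
    rw [dist_eq_norm]
    have := h c hc c' hc' hcc
    linarith
  have A_subset : A ⊆ Metric.ball (0 : Vec d) ρ := by
    refine Set.iUnion₂_subset fun c hc => Metric.ball_subset_ball' ?_
    rw [dist_zero_right]
    have := hs c hc
    linarith
  have I : (s.card : ENNReal) * ENNReal.ofReal (r ^ d) * μ (Metric.ball 0 1) ≤
      ENNReal.ofReal (ρ ^ d) * μ (Metric.ball 0 1) :=
    calc
      (s.card : ENNReal) * ENNReal.ofReal (r ^ d) * μ (Metric.ball 0 1) = μ A := by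
        rw [hA, measure_biUnion_finset D fun c _ => measurableSet_ball]
        simp only [μ.addHaar_ball_of_pos _ rpos, finrank_euclideanSpace_fin]
        simp only [Finset.sum_const, nsmul_eq_mul, mul_assoc]
      _ ≤ μ (Metric.ball (0 : Vec d) ρ) := measure_mono A_subset
      _ = ENNReal.ofReal (ρ ^ d) * μ (Metric.ball 0 1) := by
        simp only [μ.addHaar_ball_of_pos _ ρpos, finrank_euclideanSpace_fin]
  have J : (s.card : ENNReal) * ENNReal.ofReal (r ^ d) ≤ ENNReal.ofReal (ρ ^ d) :=
    (ENNReal.mul_le_mul_iff_left (Metric.measure_ball_pos _ _ zero_lt_one).ne'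
      measure_ball_lt_top.ne).1 I
  have J' := ENNReal.toReal_le_of_le_ofReal (pow_nonneg ρpos.le _) J
  rw [ENNReal.toReal_mul, ENNReal.toReal_natCast, ENNReal.toReal_ofReal (by positivity)] at J'
  have : (1 + 4 / η : ℝ) = ρ / r := by rw [hρ, hr]; field_simp; ring
  rw [this, div_pow, le_div_iff₀ (by positivity)]
  exact J'

/-- A maximal `η`-separated subset of the ball of radius `2` is an `η`-net of that ball. -/
lemma exists_net_ball_two (d : ℕ) {η : ℝ} (hη : 0 < η) :
    ∃ N : Finset (Vec d), (N.card : ℝ) ≤ (1 + 4 / η) ^ d ∧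
      ∀ μ : Vec d, ‖μ‖ ≤ 2 → ∃ c ∈ N, ‖μ - c‖ ≤ η := by
  classical
  let Sep : Finset (Vec d) → Prop := fun s =>
    (∀ c ∈ s, ‖c‖ ≤ 2) ∧ ∀ c ∈ s, ∀ c' ∈ s, c ≠ c' → η ≤ ‖c - c'‖
  let T : Set ℕ := {n | ∃ s, Sep s ∧ s.card = n}
  have hne : T.Nonempty := ⟨0, ∅, ⟨by simp, by simp⟩, rfl⟩
  have hbdd : BddAbove T := by
    refine ⟨⌊(1 + 4 / η) ^ d⌋₊, ?_⟩
    rintro _ ⟨s, hs, rfl⟩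
    exact Nat.le_floor (card_le_of_separated_ball_two hη s hs.1 hs.2)
  obtain ⟨N, hN, hcard⟩ := Nat.sSup_mem hne hbdd
  refine ⟨N, card_le_of_separated_ball_two hη N hN.1 hN.2, fun μ hμ => ?_⟩
  by_contra! hcon
  have hμN : μ ∉ N := fun h => by
    have := hcon μ h
    rw [sub_self, norm_zero] at this
    linarith
  have hins : Sep (insert μ N) := by
    refine ⟨fun c hc => ?_, fun c hc c' hc' hcc => ?_⟩
    · rcases Finset.mem_insert.1 hc with rfl | hc
      · exact hμ
      · exact hN.1 c hc
    · rcases Finset.mem_insert.1 hc with rfl | hc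
      · rcases Finset.mem_insert.1 hc' with rfl | hc'
        · exact absurd rfl hcc
        · exact (hcon c' hc').le
      · rcases Finset.mem_insert.1 hc' with heq | hc'
        · rw [heq, norm_sub_rev]; exact (hcon c hc).le
        · exact hN.2 c hc c' hc' hcc
  have := le_csSup hbdd (⟨_, hins, rfl⟩ : (insert μ N).card ∈ T)
  rw [Finset.card_insert_of_notMem hμN] at this
  omega

end Net

/-! ### The clipping operator -/

lemma clip_eq_max_min (ℓ : ℕ) (z : ℝ) :
    clip ℓ z = max (-(2 : ℝ) ^ (-(ℓ : ℤ))) (min z ((2 : ℝ) ^ (-(ℓ : ℤ)))) := by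
  have ha : (0 : ℝ) < (2 : ℝ) ^ (-(ℓ : ℤ)) := by positivity
  unfold clip
  set a := (2 : ℝ) ^ (-(ℓ : ℤ))
  rcases lt_trichotomy z 0 with hz | rfl | hz
  · rw [abs_of_neg hz, div_neg, div_self hz.ne, mul_neg_one, min_eq_left (by linarith : z ≤ a),
      ← max_neg_neg, neg_neg, max_comm]
  · simp [ha.le]
  · rw [abs_of_pos hz, div_self hz.ne', mul_one, max_eq_right]
    exact le_trans (by linarith) (le_min hz.le ha.le)

lemma continuous_clip (ℓ : ℕ) : Continuous (clip ℓ) := by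
  have : clip ℓ = fun z => max (-(2 : ℝ) ^ (-(ℓ : ℤ))) (min z ((2 : ℝ) ^ (-(ℓ : ℤ)))) :=
    funext (clip_eq_max_min ℓ)
  rw [this]
  fun_prop

lemma abs_clip_sub_clip_le (ℓ : ℕ) (z w : ℝ) : |clip ℓ z - clip ℓ w| ≤ |z - w| := by
  rw [clip_eq_max_min, clip_eq_max_min]
  refine (abs_max_sub_max_le_max _ _ _ _).trans ?_
  rw [sub_self, abs_zero, max_eq_right (abs_nonneg _)]
  refine (abs_min_sub_min_le_max _ _ _ _).trans ?_
  rw [sub_self, abs_zero, max_eq_left (abs_nonneg _)]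

lemma abs_clip_le (ℓ : ℕ) (z : ℝ) : |clip ℓ z| ≤ (2 : ℝ) ^ (-(ℓ : ℤ)) := by
  have ha : (0 : ℝ) < (2 : ℝ) ^ (-(ℓ : ℤ)) := by positivity
  rw [clip_eq_max_min, abs_le]
  exact ⟨le_max_left _ _, max_le (by linarith) (min_le_right _ _)⟩

lemma clip_mul_self (ℓ : ℕ) (z : ℝ) : clip ℓ z * z = min |z| ((2 : ℝ) ^ (-(ℓ : ℤ))) * |z| := by
  unfold clip
  rcases eq_or_ne z 0 with rfl | hz
  · simp
  · have : |z| ≠ 0 := abs_ne_zero.2 hz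
    rw [mul_assoc, div_mul_eq_mul_div, ← sq, ← sq_abs, sq, mul_div_assoc, div_self this, mul_one]

lemma clip_mul_self_nonneg (ℓ : ℕ) (z : ℝ) : 0 ≤ clip ℓ z * z := by
  rw [clip_mul_self]; positivity

/-! ### Exponential supermartingales -/

section Probability

variable {Ω : Type*} {m m0 : MeasurableSpace Ω} {P : Measure Ω} [IsProbabilityMeasure P]

lemma exp_sub_sq_le {y : ℝ} (hy : |y| ≤ 1 / 2) : Real.exp (y - y ^ 2) ≤ 1 + y := by
  obtain ⟨h1, h2⟩ := abs_le.1 hy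
  rcases le_total 0 y with h0 | h0
  · have h := Real.abs_exp_sub_one_sub_id_le (x := y - y ^ 2)
      (abs_le.2 ⟨by nlinarith, by nlinarith⟩)
    have h3 := (abs_le.1 h).2
    nlinarith [mul_nonneg (mul_nonneg h0 h0) h0,
      mul_nonneg (mul_nonneg (mul_nonneg h0 h0) h0) (by linarith : 0 ≤ 2 - y)]
  -- With `v = -y`, the second-order lower bound for `exp (v + v²)` beats `1 / (1 - v)`.
  · have h := Real.quadratic_le_exp_of_nonneg (x := -(y - y ^ 2)) (by nlinarith)
    rw [← neg_neg (y - y ^ 2), Real.exp_neg, inv_le_iff_one_le_mul₀ (Real.exp_pos _)]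
    refine le_trans ?_ (mul_le_mul_of_nonneg_left h (by linarith))
    nlinarith [mul_nonneg (sq_nonneg y) (by linarith : 0 ≤ 1 + 2 * y),
      mul_nonneg (sq_nonneg y) (by linarith : 0 ≤ -y),
      mul_nonneg (mul_nonneg (sq_nonneg y) (by linarith : 0 ≤ -y)) (by linarith : 0 ≤ 1 + 2 * y),
      mul_nonneg (mul_nonneg (sq_nonneg y) (sq_nonneg y)) (by linarith : 0 ≤ 1 + 2 * y)]

lemma exp_le_one_add_two_mul {y : ℝ} (h0 : 0 ≤ y) (h1 : y ≤ 1) : Real.exp y ≤ 1 + 2 * y := by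
  have h := convexOn_exp.2 (Set.mem_univ (0 : ℝ)) (Set.mem_univ (1 : ℝ))
    (by linarith : 0 ≤ 1 - y) h0 (by ring)
  simp only [smul_eq_mul, mul_zero, mul_one, zero_add, Real.exp_zero] at h
  nlinarith [Real.exp_one_lt_d9]

lemma integral_mul_condExp (hm : m ≤ m0) {U Z : Ω → ℝ} {B C : ℝ}
    (hU : StronglyMeasurable[m] U) (hUC : ∀ᵐ ω ∂P, |U ω| ≤ C)
    (hZ : Measurable Z) (hZB : ∀ᵐ ω ∂P, |Z ω| ≤ B) :
    ∫ ω, U ω * Z ω ∂P = ∫ ω, U ω * (P[Z | m]) ω ∂P := by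
  have hZi : Integrable Z P := Integrable.of_bound hZ.aestronglyMeasurable B hZB
  have hUZ : Integrable (U * Z) P := by
    refine Integrable.of_bound ((hU.mono hm).aestronglyMeasurable.mul hZ.aestronglyMeasurable)
      (C * B) ?_
    filter_upwards [hUC, hZB] with ω h1 h2
    rw [Pi.mul_apply, norm_mul]
    exact mul_le_mul h1 h2 (norm_nonneg _) ((abs_nonneg _).trans h1)
  have h := condExp_mul_of_stronglyMeasurable_left hU hUZ hZi
  calc ∫ ω, U ω * Z ω ∂P = ∫ ω, (P[U * Z | m]) ω ∂P := (integral_condExp hm).symm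
    _ = _ := integral_congr_ae h

/-- Supermartingale step for the self-normalized exponential `exp (Y - Y²)`, where `Y = c * ε` is a
bounded martingale increment. -/
lemma integral_mul_exp_sub_sq_le (hm : m ≤ m0) {W c ε : Ω → ℝ} {C : ℝ}
    (hW : StronglyMeasurable[m] W) (hW0 : ∀ᵐ ω ∂P, 0 ≤ W ω) (hWC : ∀ᵐ ω ∂P, W ω ≤ C)
    (hc : StronglyMeasurable[m] c) (hc4 : ∀ ω, |c ω| ≤ 1 / 4)
    (hε : Measurable ε) (hε2 : ∀ᵐ ω ∂P, |ε ω| ≤ 2) (hmean : P[ε | m] =ᵐ[P] 0) :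
    ∫ ω, W ω * Real.exp (c ω * ε ω - (c ω * ε ω) ^ 2) ∂P ≤ ∫ ω, W ω ∂P := by
  have hcm := (hc.mono hm).measurable
  have hWm := (hW.mono hm).measurable
  have hy : ∀ᵐ ω ∂P, |c ω * ε ω| ≤ 1 / 2 := by
    filter_upwards [hε2] with ω h
    rw [abs_mul]
    have := mul_le_mul (hc4 ω) h (abs_nonneg _) (by norm_num)
    linarith
  have hUC : ∀ᵐ ω ∂P, |W ω * c ω| ≤ C * (1 / 4) := by
    filter_upwards [hW0, hWC] with ω h1 h2
    rw [abs_mul, abs_of_nonneg h1]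
    exact mul_le_mul h2 (hc4 ω) (abs_nonneg _) (h1.trans h2)
  have hzero : ∫ ω, W ω * c ω * ε ω ∂P = 0 := by
    refine (integral_mul_condExp hm (hW.mul hc) hUC hε hε2).trans ?_
    rw [integral_congr_ae (g := fun _ => 0), integral_zero]
    filter_upwards [hmean] with ω h
    simp [h]
  have hWi : Integrable W P := Integrable.of_bound hWm.aestronglyMeasurable C (by
    filter_upwards [hW0, hWC] with ω h1 h2
    rwa [Real.norm_of_nonneg h1])
  have hWcε : Integrable (fun ω => W ω * c ω * ε ω) P :=
    Integrable.of_bound ((hWm.mul hcm).mul hε).aestronglyMeasurable (C * (1 / 4) * 2) (by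
      filter_upwards [hUC, hε2] with ω h1 h2
      rw [norm_mul]
      exact mul_le_mul h1 h2 (norm_nonneg _) ((abs_nonneg _).trans h1))
  have hle : ∀ᵐ ω ∂P, W ω * Real.exp (c ω * ε ω - (c ω * ε ω) ^ 2) ≤ W ω + W ω * c ω * ε ω := by
    filter_upwards [hW0, hy] with ω h1 h2
    have := mul_le_mul_of_nonneg_left (exp_sub_sq_le h2) h1
    linarith
  have hint : Integrable (fun ω => W ω * Real.exp (c ω * ε ω - (c ω * ε ω) ^ 2)) P := by
    refine (hWi.add hWcε).mono' (hWm.mul (by fun_prop)).aestronglyMeasurable ?_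
    filter_upwards [hle, hW0] with ω h1 h2
    rwa [Real.norm_of_nonneg (mul_nonneg h2 (Real.exp_pos _).le)]
  calc _ ≤ ∫ ω, (W ω + W ω * c ω * ε ω) ∂P := integral_mono_ae hint (hWi.add hWcε) hle
    _ = ∫ ω, W ω ∂P := by rw [integral_add hWi hWcε, hzero, add_zero]

/-- Supermartingale step for `exp (ε² / 4 - w / 2)`, where `w` is the conditional second moment
of `ε`. -/
lemma integral_mul_exp_sq_sub_le (hm : m ≤ m0) {W w ε : Ω → ℝ} {C : ℝ}
    (hW : StronglyMeasurable[m] W) (hW0 : ∀ᵐ ω ∂P, 0 ≤ W ω) (hWC : ∀ᵐ ω ∂P, W ω ≤ C)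
    (hw : StronglyMeasurable[m] w) (hw0 : ∀ᵐ ω ∂P, 0 ≤ w ω)
    (hε : Measurable ε) (hε2 : ∀ᵐ ω ∂P, |ε ω| ≤ 2)
    (hvar : P[fun ω => ε ω ^ 2 | m] =ᵐ[P] w) :
    ∫ ω, W ω * Real.exp (ε ω ^ 2 / 4 - w ω / 2) ∂P ≤ ∫ ω, W ω ∂P := by
  have hwm := (hw.mono hm).measurable
  have hWm := (hW.mono hm).measurable
  have hWi : Integrable W P := Integrable.of_bound hWm.aestronglyMeasurable C (by
    filter_upwards [hW0, hWC] with ω h1 h2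
    rwa [Real.norm_of_nonneg h1])
  -- `exp (ε² / 4) ≤ 1 + ε² / 2`, and `U` is what is left for conditioning on `m`.
  set U : Ω → ℝ := fun ω => W ω * Real.exp (-(w ω * (1 / 2))) with hUdef
  have hUm : StronglyMeasurable[m] U :=
    hW.mul (Real.continuous_exp.comp_stronglyMeasurable (hw.mul_const (1 / 2)).neg)
  have hU0 : ∀ᵐ ω ∂P, 0 ≤ U ω := by
    filter_upwards [hW0] with ω h1
    exact mul_nonneg h1 (Real.exp_pos _).le
  have hUW : ∀ᵐ ω ∂P, U ω * (1 + w ω / 2) ≤ W ω := by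
    filter_upwards [hW0] with ω h1
    have h2 := Real.add_one_le_exp (w ω / 2)
    have h3 : Real.exp (-(w ω / 2)) * (1 + w ω / 2) ≤ 1 := by
      rw [Real.exp_neg, inv_mul_le_iff₀ (Real.exp_pos _)]; linarith
    calc U ω * (1 + w ω / 2) = W ω * (Real.exp (-(w ω / 2)) * (1 + w ω / 2)) := by
          simp only [hUdef, mul_one_div]; ring
      _ ≤ W ω * 1 := mul_le_mul_of_nonneg_left h3 h1
      _ = W ω := mul_one _
  have hUC : ∀ᵐ ω ∂P, |U ω| ≤ C := by
    filter_upwards [hU0, hUW, hw0, hWC] with ω h1 h2 h3 h4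
    rw [abs_of_nonneg h1]
    nlinarith
  have hsqB : ∀ᵐ ω ∂P, |ε ω ^ 2| ≤ 4 := by
    filter_upwards [hε2] with ω h
    rw [abs_pow]
    nlinarith [abs_nonneg (ε ω)]
  have hUi : Integrable U P :=
    Integrable.of_bound (hUm.mono hm).aestronglyMeasurable C hUC
  have hUmm := (hUm.mono hm).measurable
  have hUεi : Integrable (fun ω => U ω * ε ω ^ 2) P := by
    refine Integrable.of_bound (hUmm.mul (hε.pow_const 2)).aestronglyMeasurable (C * 4) ?_
    filter_upwards [hUC, hsqB] with ω h1 h2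
    rw [norm_mul]
    exact mul_le_mul h1 h2 (norm_nonneg _) ((abs_nonneg _).trans h1)
  have hUw : ∫ ω, U ω * ε ω ^ 2 ∂P = ∫ ω, U ω * w ω ∂P := by
    rw [integral_mul_condExp hm hUm hUC (hε.pow_const 2) hsqB]
    refine integral_congr_ae ?_
    filter_upwards [hvar] with ω h
    rw [h]
  have hUwi : Integrable (fun ω => U ω * w ω) P := by
    refine (hWi.const_mul 2).mono' (hUmm.mul hwm).aestronglyMeasurable ?_
    filter_upwards [hU0, hUW, hw0] with ω h1 h2 h3
    rw [Real.norm_of_nonneg (by positivity)]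
    linarith
  have hle : ∀ᵐ ω ∂P, W ω * Real.exp (ε ω ^ 2 / 4 - w ω / 2) ≤ U ω + U ω * ε ω ^ 2 / 2 := by
    filter_upwards [hU0, hsqB] with ω h1 h2
    rw [abs_of_nonneg (sq_nonneg _)] at h2
    have h3 := exp_le_one_add_two_mul (y := ε ω ^ 2 / 4) (by positivity) (by linarith)
    calc W ω * Real.exp (ε ω ^ 2 / 4 - w ω / 2) = U ω * Real.exp (ε ω ^ 2 / 4) := by
          simp only [hUdef, sub_eq_add_neg, Real.exp_add, mul_one_div]; ring
      _ ≤ U ω * (1 + 2 * (ε ω ^ 2 / 4)) := mul_le_mul_of_nonneg_left h3 h1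
      _ = _ := by ring
  have hint : Integrable (fun ω => W ω * Real.exp (ε ω ^ 2 / 4 - w ω / 2)) P := by
    refine (hUi.add (hUεi.div_const 2)).mono'
      (hWm.mul (by fun_prop)).aestronglyMeasurable ?_
    filter_upwards [hle, hW0] with ω h1 h2
    rwa [Real.norm_of_nonneg (mul_nonneg h2 (Real.exp_pos _).le)]
  calc _ ≤ ∫ ω, (U ω + U ω * ε ω ^ 2 / 2) ∂P :=
        integral_mono_ae hint (hUi.add (hUεi.div_const 2)) hle
    _ = ∫ ω, (U ω + U ω * w ω / 2) ∂P := by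
        rw [integral_add hUi (hUεi.div_const 2), integral_add hUi (hUwi.div_const 2),
          integral_div, integral_div, hUw]
    _ ≤ ∫ ω, W ω ∂P := by
        refine integral_mono_ae (hUi.add (hUwi.div_const 2)) hWi ?_
        filter_upwards [hUW] with ω h
        linarith

/-- Markov's inequality for an exponential of mean at most one. -/
lemma measure_lt_le_of_integral_exp_le_one {Y : Ω → ℝ} (hY : Measurable Y) {B : ℝ}
    (hYB : ∀ᵐ ω ∂P, Y ω ≤ B) (h1 : ∫ ω, Real.exp (Y ω) ∂P ≤ 1) (Λ : ℝ) :
    P {ω | Λ < Y ω} ≤ ENNReal.ofReal (Real.exp (-Λ)) := by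
  have hint : Integrable (fun ω => Real.exp (Y ω)) P := by
    refine Integrable.of_bound (by fun_prop) (Real.exp B) ?_
    filter_upwards [hYB] with ω h
    rw [Real.norm_of_nonneg (Real.exp_pos _).le]
    exact Real.exp_le_exp.2 h
  have h := mul_meas_ge_le_integral_of_nonneg (μ := P)
    (ae_of_all _ fun ω => (Real.exp_pos (Y ω)).le) hint (Real.exp Λ)
  have h2 : P.real {ω | Real.exp Λ ≤ Real.exp (Y ω)} ≤ Real.exp (-Λ) := by
    rw [Real.exp_neg, ← one_div, le_div_iff₀ (Real.exp_pos _), mul_comm]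
    exact h.trans h1
  calc P {ω | Λ < Y ω} ≤ P {ω | Real.exp Λ ≤ Real.exp (Y ω)} :=
        measure_mono fun ω hω => Real.exp_le_exp.2 (le_of_lt hω)
    _ = ENNReal.ofReal (P.real {ω | Real.exp Λ ≤ Real.exp (Y ω)}) :=
        (ENNReal.ofReal_toReal (measure_ne_top _ _)).symm
    _ ≤ _ := ENNReal.ofReal_le_ofReal h2

end Probability

/-! ### Concentration of the noise -/

section Bandit

variable {d : ℕ} {Ω : Type*}

section History

variable {x : ℕ → Ω → Vec d} {ε : ℕ → Ω → ℝ}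

lemma measurable_arm_history {s k : ℕ} (h : s ≤ k) : Measurable[history x ε k] (x s) := by
  rw [measurable_iff_comap_le]
  rcases h.lt_or_eq with h | rfl
  · exact le_sup_of_le_left (le_iSup₂_of_le s (Finset.mem_range.2 h) le_sup_left)
  · exact le_sup_right

lemma measurable_noise_history {s k : ℕ} (h : s < k) : Measurable[history x ε k] (ε s) := by
  rw [measurable_iff_comap_le]
  exact le_sup_of_le_left (le_iSup₂_of_le s (Finset.mem_range.2 h) le_sup_right)

lemma history_mono {s k : ℕ} (h : s ≤ k) : history x ε s ≤ history x ε k := by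
  refine sup_le (iSup₂_le fun t ht => sup_le ?_ ?_) ?_
  · exact (measurable_arm_history ((Finset.mem_range.1 ht).le.trans h)).comap_le
  · exact (measurable_noise_history ((Finset.mem_range.1 ht).trans_le h)).comap_le
  · exact (measurable_arm_history h).comap_le

lemma history_le [m0 : MeasurableSpace Ω] {k : ℕ} (hx : ∀ s ≤ k, Measurable (x s))
    (hε : ∀ s < k, Measurable (ε s)) : history x ε k ≤ m0 := by
  refine sup_le (iSup₂_le fun t ht => sup_le ?_ ?_) ?_
  · exact (hx t (Finset.mem_range.1 ht).le).comap_le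
  · exact (hε t (Finset.mem_range.1 ht)).comap_le
  · exact (hx k le_rfl).comap_le

end History

variable [m0 : MeasurableSpace Ω] {P : Measure Ω} [IsProbabilityMeasure P]
  {x : ℕ → Ω → Vec d} {ε σ : ℕ → Ω → ℝ} {K : ℕ}

/-- Tail bound for one self-normalized sum of clipped noise, at a fixed direction, level, and
tilting parameter `t`. -/
lemma measure_selfNormalized_sum_le (hx : ∀ k < K, Measurable (x k))
    (hε : ∀ k < K, Measurable (ε k)) (hε2 : ∀ k < K, ∀ᵐ ω ∂P, |ε k ω| ≤ 2)
    (hmean : ∀ k < K, P[ε k | history x ε k] =ᵐ[P] 0) (μ : Vec d) (ℓ : ℕ) {t : ℝ}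
    (ht : |t| * (2 : ℝ) ^ (-(ℓ : ℤ)) ≤ 1 / 4) {n : ℕ} (hn : n ≤ K) (Λ : ℝ) :
    P {ω | Λ < ∑ s ∈ Finset.range n, (t * (clip ℓ (inner ℝ (x s ω) μ) * ε s ω)
        - t ^ 2 * (clip ℓ (inner ℝ (x s ω) μ) * ε s ω) ^ 2)}
      ≤ ENNReal.ofReal (Real.exp (-Λ)) := by
  set c : ℕ → Ω → ℝ := fun s ω => t * clip ℓ (inner ℝ (x s ω) μ) with hc
  have hc4 : ∀ s ω, |c s ω| ≤ 1 / 4 := fun s ω => by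
    rw [hc, abs_mul]
    exact (mul_le_mul_of_nonneg_left (abs_clip_le _ _) (abs_nonneg _)).trans ht
  have hcontc : Continuous fun v : Vec d => t * clip ℓ (inner ℝ v μ) := by
    have := continuous_clip ℓ
    fun_prop
  have hcmeas : ∀ {m : MeasurableSpace Ω} {s : ℕ}, Measurable[m] (x s) → Measurable[m] (c s) :=
    fun h => hcontc.measurable.comp h
  set y : ℕ → Ω → ℝ := fun s ω => c s ω * ε s ω - (c s ω * ε s ω) ^ 2 with hy
  have hymeas : ∀ {m : MeasurableSpace Ω} {s : ℕ}, Measurable[m] (x s) → Measurable[m] (ε s) →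
      Measurable[m] (y s) := fun h1 h2 =>
    ((hcmeas h1).mul h2).sub (((hcmeas h1).mul h2).pow_const 2)
  have hSmeas : ∀ {m : MeasurableSpace Ω} {k : ℕ}, (∀ s < k, Measurable[m] (x s)) →
      (∀ s < k, Measurable[m] (ε s)) →
      Measurable[m] fun ω => ∑ s ∈ Finset.range k, y s ω := fun h1 h2 =>
    Finset.measurable_fun_sum _ fun s hs =>
      hymeas (h1 s (Finset.mem_range.1 hs)) (h2 s (Finset.mem_range.1 hs))
  have hyB : ∀ s ω, y s ω ≤ 1 := fun s ω => by
    simp only [hy]; nlinarith [sq_nonneg (c s ω * ε s ω - 1 / 2)]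
  have hSB : ∀ k ω, ∑ s ∈ Finset.range k, y s ω ≤ k := fun k ω => by
    calc _ ≤ ∑ s ∈ Finset.range k, (1 : ℝ) := Finset.sum_le_sum fun s _ => hyB s ω
      _ = k := by simp
  have hint : ∀ k ≤ K, ∫ ω, Real.exp (∑ s ∈ Finset.range k, y s ω) ∂P ≤ 1 := by
    intro k
    induction k with
    | zero => simp
    | succ k ih =>
      intro hk
      refine le_trans ?_ (ih (by omega))
      simp only [Finset.sum_range_succ, Real.exp_add]
      have hm : history x ε k ≤ m0 :=
        history_le (fun s hs => hx s (by omega)) fun s hs => hε s (by omega)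
      refine integral_mul_exp_sub_sq_le (m := history x ε k) (C := Real.exp k) (ε := ε k) hm
        ?_ ?_ ?_ ?_ (hc4 k) (hε k (by omega)) (hε2 k (by omega)) (hmean k (by omega))
      · exact (Real.measurable_exp.comp (hSmeas (fun s hs => measurable_arm_history hs.le)
          fun s hs => measurable_noise_history hs)).stronglyMeasurable
      · exact ae_of_all _ fun ω => (Real.exp_pos _).le
      · exact ae_of_all _ fun ω => Real.exp_le_exp.2 (hSB k ω)
      · exact (hcmeas (measurable_arm_history le_rfl)).stronglyMeasurable
  have h := measure_lt_le_of_integral_exp_le_one (P := P)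
    (Y := fun ω => ∑ s ∈ Finset.range n, y s ω)
    (hSmeas (fun s hs => hx s (by omega)) fun s hs => hε s (by omega))
    (ae_of_all _ (hSB n)) (hint n hn) Λ
  convert h using 5
  refine Finset.sum_congr rfl fun s _ => ?_
  simp only [hy, hc]; ring

/-- The empirical quadratic variation is controlled by the conditional one. -/
lemma measure_sum_sq_noise_gt_le (hx : ∀ k < K, Measurable (x k))
    (hε : ∀ k < K, Measurable (ε k)) (hε2 : ∀ k < K, ∀ᵐ ω ∂P, |ε k ω| ≤ 2)
    (hvar : ∀ k < K, P[fun ω => ε k ω ^ 2 | history x ε k] =ᵐ[P] fun ω => σ k ω ^ 2) (Λ : ℝ) :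
    P {ω | 2 * (∑ k ∈ Finset.range K, σ k ω ^ 2) + 4 * Λ < ∑ k ∈ Finset.range K, ε k ω ^ 2}
      ≤ ENNReal.ofReal (Real.exp (-Λ)) := by
  -- `σ s ^ 2` is only almost everywhere equal to a function measurable in the history, so the
  -- conditional expectation itself is used.
  set w : ℕ → Ω → ℝ := fun s => P[fun ω => ε s ω ^ 2 | history x ε s] with hw
  have hw0 : ∀ s, ∀ᵐ ω ∂P, 0 ≤ w s ω := fun s =>
    condExp_nonneg (ae_of_all _ fun ω => sq_nonneg (ε s ω))
  have hwm : ∀ {s k : ℕ}, s ≤ k → Measurable[history x ε k] (w s) := fun h =>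
    (stronglyMeasurable_condExp.mono (history_mono h)).measurable
  have hm : ∀ k < K, history x ε k ≤ m0 := fun k hk =>
    history_le (fun s hs => hx s (by omega)) fun s hs => hε s (by omega)
  set y : ℕ → Ω → ℝ := fun s ω => ε s ω ^ 2 / 4 - w s ω / 2 with hy
  have hymeas : ∀ {m : MeasurableSpace Ω} {s : ℕ}, Measurable[m] (ε s) → Measurable[m] (w s) →
      Measurable[m] (y s) := fun h1 h2 => ((h1.pow_const 2).div_const 4).sub (h2.div_const 2)
  have hSmeas : ∀ {m : MeasurableSpace Ω} {k : ℕ}, (∀ s < k, Measurable[m] (ε s)) →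
      (∀ s < k, Measurable[m] (w s)) →
      Measurable[m] fun ω => ∑ s ∈ Finset.range k, y s ω := fun h1 h2 =>
    Finset.measurable_fun_sum _ fun s hs =>
      hymeas (h1 s (Finset.mem_range.1 hs)) (h2 s (Finset.mem_range.1 hs))
  have hyB : ∀ s < K, ∀ᵐ ω ∂P, y s ω ≤ 1 := fun s hs => by
    filter_upwards [hw0 s, hε2 s hs] with ω h1 h2
    have : ε s ω ^ 2 ≤ 4 := by rw [← sq_abs]; nlinarith [abs_nonneg (ε s ω)]
    simp only [hy]; linarith
  have hSB : ∀ k ≤ K, ∀ᵐ ω ∂P, ∑ s ∈ Finset.range k, y s ω ≤ k := fun k hk => by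
    have : ∀ᵐ ω ∂P, ∀ s ∈ Finset.range k, y s ω ≤ 1 :=
      (Finset.eventually_all _).2 fun s hs => hyB s ((Finset.mem_range.1 hs).trans_le hk)
    filter_upwards [this] with ω h
    calc _ ≤ ∑ s ∈ Finset.range k, (1 : ℝ) := Finset.sum_le_sum h
      _ = k := by simp
  have hint : ∀ k ≤ K, ∫ ω, Real.exp (∑ s ∈ Finset.range k, y s ω) ∂P ≤ 1 := by
    intro k
    induction k with
    | zero => simp
    | succ k ih =>
      intro hk
      refine le_trans ?_ (ih (by omega))
      simp only [Finset.sum_range_succ, Real.exp_add]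
      refine integral_mul_exp_sq_sub_le (m := history x ε k) (C := Real.exp k) (ε := ε k)
        (hm k (by omega)) ?_ ?_ ?_ ?_ (hw0 k) (hε k (by omega)) (hε2 k (by omega))
        Filter.EventuallyEq.rfl
      · exact (Real.measurable_exp.comp (hSmeas (fun s hs => measurable_noise_history hs)
          fun s hs => hwm hs.le)).stronglyMeasurable
      · exact ae_of_all _ fun ω => (Real.exp_pos _).le
      · filter_upwards [hSB k (by omega)] with ω h using Real.exp_le_exp.2 h
      · exact stronglyMeasurable_condExp
  have h := measure_lt_le_of_integral_exp_le_one (P := P)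
    (Y := fun ω => ∑ s ∈ Finset.range K, y s ω)
    (hSmeas hε fun s hs => (hwm le_rfl).mono (hm s hs) le_rfl)
    (hSB K le_rfl) (hint K le_rfl) Λ
  refine le_trans (measure_mono_ae ?_) h
  have hall : ∀ᵐ ω ∂P, ∀ s ∈ Finset.range K, w s ω = σ s ω ^ 2 :=
    (Finset.eventually_all _).2 fun s hs => hvar s (Finset.mem_range.1 hs)
  filter_upwards [hall] with ω hω hlt
  change 2 * (∑ k ∈ Finset.range K, σ k ω ^ 2) + 4 * Λ < ∑ k ∈ Finset.range K, ε k ω ^ 2 at hlt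
  change Λ < ∑ s ∈ Finset.range K, y s ω
  simp only [hy]
  rw [Finset.sum_sub_distrib, ← Finset.sum_div, ← Finset.sum_div, Finset.sum_congr rfl hω]
  linarith

end Bandit

/-! ### Validity of the confidence sets -/

/-- Optimizing the tilting parameter over a dyadic grid. -/
lemma abs_sum_le_of_dyadic_tilts {a Λ : ℝ} (ha : 0 < a) (hΛ : 1 ≤ Λ) {K n : ℕ} (hK : 0 < K)
    (hn : n ≤ K) {X : ℕ → ℝ} (hX : ∀ s < n, |X s| ≤ 2 * a)
    (h : ∀ j < K, ∀ e ∈ ({1, -1} : Finset ℝ), ∑ s ∈ Finset.range n,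
      (e / (4 * a * 2 ^ j) * X s - (e / (4 * a * 2 ^ j)) ^ 2 * X s ^ 2) ≤ Λ) :
    |∑ s ∈ Finset.range n, X s| ≤ 3 * √((∑ s ∈ Finset.range n, X s ^ 2) * Λ) + 4 * a * Λ := by
  set S := ∑ s ∈ Finset.range n, X s with hS
  set Q := ∑ s ∈ Finset.range n, X s ^ 2 with hQ
  have hQ0 : 0 ≤ Q := Finset.sum_nonneg fun s _ => sq_nonneg _
  have key : ∀ j < K, |S| ≤ Q / (4 * a * 2 ^ j) + Λ * (4 * a * 2 ^ j) := by
    intro j hj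
    have hp : 0 < 4 * a * 2 ^ j := by positivity
    have aux : ∀ e ∈ ({1, -1} : Finset ℝ), e * S ≤ Q / (4 * a * 2 ^ j) + Λ * (4 * a * 2 ^ j) := by
      intro e he
      have he2 : e ^ 2 = 1 := by
        rcases Finset.mem_insert.1 he with rfl | he
        · norm_num
        · rw [Finset.mem_singleton.1 he]; norm_num
      have h1 := h j hj e he
      rw [Finset.sum_sub_distrib, ← Finset.mul_sum, ← Finset.mul_sum, ← hS, ← hQ, div_pow, he2]
        at h1
      set p := 4 * a * 2 ^ j
      have h2 : e * S = (e / p * S - 1 / p ^ 2 * Q) * p + Q / p := by field_simp; ring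
      rw [h2]
      have := mul_le_mul_of_nonneg_right h1 hp.le
      linarith
    have h1 := aux 1 (by simp)
    have h2 := aux (-1) (by simp)
    exact abs_le.2 ⟨by linarith, by linarith⟩
  rw [Real.sqrt_mul hQ0]
  set q := √Q with hq
  set l := √Λ with hl
  have hq2 : q ^ 2 = Q := Real.sq_sqrt hQ0
  have hl2 : l ^ 2 = Λ := Real.sq_sqrt (by linarith)
  have hq0 : 0 ≤ q := Real.sqrt_nonneg _
  have hl1 : 1 ≤ l := Real.one_le_sqrt.2 hΛ
  -- The ideal tilt is `√(Λ / Q)`. Either it exceeds the largest tilt `1 / (4 a)` of the grid, or it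
  -- lies within a factor `2` of a tilt with `j < K`, because `Q ≤ 4 a² K`.
  rcases le_or_gt q (4 * a * l) with hcase | hcase
  · have h0 := key 0 hK
    have h1 : Q / (4 * a * 2 ^ 0) ≤ q * l := by
      rw [pow_zero, mul_one, div_le_iff₀ (by positivity), ← hq2]
      nlinarith
    have h2 : Λ * (4 * a * 2 ^ 0) = 4 * a * Λ := by ring
    have : 0 ≤ q * l := by positivity
    linarith
  · set ρ := q / (4 * a * l) with hρ
    have hp : 0 < 4 * a * l := by positivity
    have hρ1 : 1 ≤ ρ := by rw [hρ, le_div_iff₀ hp]; linarith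
    have hqρ : q = ρ * (4 * a * l) := by rw [hρ]; field_simp
    obtain ⟨j, hj1, hj2⟩ := exists_nat_pow_near hρ1 (by norm_num : (1 : ℝ) < 2)
    have hQK : Q ≤ K * (4 * a ^ 2) := by
      calc Q ≤ ∑ s ∈ Finset.range n, 4 * a ^ 2 := by
            refine Finset.sum_le_sum fun s hs => ?_
            have := hX s (Finset.mem_range.1 hs)
            rw [← sq_abs]
            nlinarith [abs_nonneg (X s)]
        _ = n * (4 * a ^ 2) := by simp
        _ ≤ _ := by gcongr
    have hρK : ρ ^ 2 ≤ K := by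
      have h1 : ρ ^ 2 * (4 * a ^ 2) ≤ K * (4 * a ^ 2) := by
        refine le_trans ?_ hQK
        rw [← hq2, hqρ]
        have : 1 ≤ l ^ 2 := by nlinarith
        nlinarith [mul_nonneg (sq_nonneg (ρ * a)) (by linarith : 0 ≤ l ^ 2 - 1), sq_nonneg (ρ * a)]
      exact le_of_mul_le_mul_right h1 (by positivity)
    have hjK : j < K := by
      by_contra! hcon
      have h1 : (K : ℝ) < 2 ^ K := by exact_mod_cast Nat.lt_two_pow_self
      have h2 : (2 : ℝ) ^ K ≤ 2 ^ j := pow_le_pow_right₀ (by norm_num) hcon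
      nlinarith
    have h0 := key j hjK
    have h2j : (0 : ℝ) < 2 ^ j := by positivity
    have h1 : Q / (4 * a * 2 ^ j) ≤ 2 * (q * l) := by
      rw [div_le_iff₀ (by positivity), ← hq2]
      rw [pow_succ] at hj2
      have : q ≤ 2 * (l * (4 * a * 2 ^ j)) := by rw [hqρ]; nlinarith
      nlinarith
    have h2 : Λ * (4 * a * 2 ^ j) ≤ q * l := by
      rw [hqρ, ← hl2]
      have := mul_le_mul_of_nonneg_left hj1 (by positivity : 0 ≤ 4 * a * l ^ 2)
      linarith
    have : 0 ≤ 4 * a * Λ := by positivity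
    linarith

lemma one_le_numLevels (d K : ℕ) : 1 ≤ numLevels d K := le_max_left _ _

/-- The number `12 K 2 ^ L` in the definition of the confidence width is at least one. -/
lemma one_le_width_base {K : ℕ} (d : ℕ) (hK : 0 < K) :
    (1 : ℝ) ≤ 12 * (K : ℝ) * 2 ^ numLevels d K := by
  have h1 : (1 : ℝ) ≤ K := by exact_mod_cast hK
  have h2 : (1 : ℝ) ≤ 2 ^ numLevels d K := one_le_pow₀ (by norm_num)
  nlinarith

lemma one_le_log_inv {δ : ℝ} (h0 : 0 < δ) (h1 : δ ≤ Real.exp (-1)) : 1 ≤ Real.log (1 / δ) := by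
  rw [one_div, Real.log_inv]
  have := Real.log_le_log h0 h1
  rw [Real.log_exp] at this
  linarith

lemma iota_eq {d K : ℕ} {δ : ℝ} (hK : 0 < K) (h0 : 0 < δ) :
    iota d K δ = 128 * ((d + 2) * Real.log (12 * (K : ℝ) * 2 ^ numLevels d K)
      + Real.log (1 / δ)) := by
  have := one_le_width_base d hK
  rw [iota, div_eq_mul_one_div, Real.log_mul (by positivity) (by positivity), Real.log_pow]
  push_cast; rfl

lemma log_inv_le_iota {d K : ℕ} {δ : ℝ} (hK : 0 < K) (h0 : 0 < δ) :
    128 * Real.log (1 / δ) ≤ iota d K δ := by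
  rw [iota_eq hK h0]
  have := Real.log_nonneg (one_le_width_base d hK)
  have : 0 ≤ ((d : ℝ) + 2) * Real.log (12 * (K : ℝ) * 2 ^ numLevels d K) := by positivity
  linarith

section

variable {d : ℕ}

/-- If the self-normalized inequalities hold at all points of a net, levels, dyadic tilts, signs and
times, then `θ` is in every confidence set: clipping is `1`-Lipschitz, so passing to a net point
at distance `1 / (K 2 ^ L)` costs at most a multiple of `2 ^ (-ℓ)`. -/
lemma mem_confSet_of_net {K : ℕ} {δ : ℝ} (hK : 0 < K) (h0 : 0 < δ) (h1 : δ ≤ Real.exp (-1))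
    {x : ℕ → Vec d} {y : ℕ → ℝ} {θ : Vec d} (hθ : ‖θ‖ ≤ 1) (hx : ∀ s < K, ‖x s‖ ≤ 1)
    (hres : ∀ s < K, |noiseResidual x y s θ| ≤ 2) {N : Finset (Vec d)}
    (hN : ∀ μ : Vec d, ‖μ‖ ≤ 2 → ∃ c ∈ N, ‖μ - c‖ ≤ 1 / (K * 2 ^ numLevels d K))
    (h : ∀ c ∈ N, ∀ ℓ ∈ Finset.Icc 1 (numLevels d K), ∀ j < K, ∀ n ≤ K,
      ∀ e ∈ ({1, -1} : Finset ℝ), ∑ s ∈ Finset.range n,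
        (e / (4 * (2 : ℝ) ^ (-(ℓ : ℤ)) * 2 ^ j)
            * (clip ℓ (inner ℝ (x s) c) * noiseResidual x y s θ)
          - (e / (4 * (2 : ℝ) ^ (-(ℓ : ℤ)) * 2 ^ j)) ^ 2
            * (clip ℓ (inner ℝ (x s) c) * noiseResidual x y s θ) ^ 2) ≤ iota d K δ / 128)
    {n : ℕ} (hn : n ≤ K) : θ ∈ confSet K δ x y n := by
  intro ℓ hℓ
  refine ⟨hθ, fun μ hμ => ?_⟩
  obtain ⟨c, hcN, hc⟩ := hN μ hμ
  set a := (2 : ℝ) ^ (-(ℓ : ℤ)) with ha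
  have ha0 : 0 < a := by positivity
  set η : ℝ := 1 / (K * 2 ^ numLevels d K) with hη
  have hK0 : (0 : ℝ) < K := by exact_mod_cast hK
  have hK1 : (1 : ℝ) ≤ K := by exact_mod_cast hK
  have hη0 : 0 < η := by positivity
  have hKη : K * η ≤ a := by
    have : K * η = (2 : ℝ) ^ (-(numLevels d K : ℤ)) := by
      rw [hη, zpow_neg, zpow_natCast]; field_simp
    rw [this, ha]
    refine zpow_le_zpow_right₀ (by norm_num) ?_
    have := (Finset.mem_Icc.1 hℓ).2
    omega
  set Λ := iota d K δ / 128 with hΛ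
  have hΛ1 : 1 ≤ Λ := by
    have h2 := log_inv_le_iota (d := d) hK h0
    have h3 := one_le_log_inv h0 h1
    rw [hΛ]; linarith
  have hι : iota d K δ = 128 * Λ := by rw [hΛ]; ring
  set z : ℕ → ℝ := fun s => noiseResidual x y s θ with hz
  set A : ℕ → ℝ := fun s => clip ℓ (inner ℝ (x s) μ) with hA
  set B : ℕ → ℝ := fun s => clip ℓ (inner ℝ (x s) c) with hB
  have hAB : ∀ s < n, |B s - A s| ≤ η := fun s hs => by
    refine (abs_clip_sub_clip_le _ _ _).trans ?_
    rw [← inner_sub_right, ← neg_sub μ c, inner_neg_right, abs_neg]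
    refine (abs_real_inner_le_norm _ _).trans ?_
    have := hx s (by omega)
    nlinarith [norm_nonneg (x s), norm_nonneg (μ - c)]
  have hzB : ∀ s < n, |z s| ≤ 2 := fun s hs => hres s (by omega)
  have hmain := abs_sum_le_of_dyadic_tilts (X := fun s => B s * z s) ha0 hΛ1 hK hn
    (fun s hs => by
      rw [abs_mul]
      have h2 : |B s| ≤ a := abs_clip_le _ _
      have h3 := hzB s hs
      calc |B s| * |z s| ≤ a * 2 := mul_le_mul h2 h3 (abs_nonneg _) ha0.le
        _ = 2 * a := by ring)
    (fun j hj e he => h c hcN ℓ hℓ j hj n hn e he)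
  have hnK : (n : ℝ) ≤ K := by exact_mod_cast hn
  have hS : |∑ s ∈ Finset.range n, A s * z s| ≤ |∑ s ∈ Finset.range n, B s * z s| + 2 * a := by
    have h2 : |∑ s ∈ Finset.range n, B s * z s - ∑ s ∈ Finset.range n, A s * z s| ≤ 2 * a := by
      rw [← Finset.sum_sub_distrib]
      calc _ ≤ ∑ s ∈ Finset.range n, |B s * z s - A s * z s| := Finset.abs_sum_le_sum_abs _ _
        _ ≤ ∑ s ∈ Finset.range n, η * 2 := by
            refine Finset.sum_le_sum fun s hs => ?_
            rw [← sub_mul, abs_mul]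
            exact mul_le_mul (hAB s (Finset.mem_range.1 hs)) (hzB s (Finset.mem_range.1 hs))
              (abs_nonneg _) hη0.le
        _ = n * (η * 2) := by simp
        _ ≤ K * (η * 2) := by gcongr
        _ ≤ 2 * a := by linarith
    have h3 := abs_sub_abs_le_abs_sub (∑ s ∈ Finset.range n, A s * z s)
      (∑ s ∈ Finset.range n, B s * z s)
    rw [abs_sub_comm] at h3
    linarith
  set QA := ∑ s ∈ Finset.range n, A s ^ 2 * z s ^ 2 with hQA
  have hQA0 : 0 ≤ QA := Finset.sum_nonneg fun s _ => by positivity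
  have hQ : ∑ s ∈ Finset.range n, (B s * z s) ^ 2 ≤ 2 * QA + 8 * a ^ 2 := by
    calc _ ≤ ∑ s ∈ Finset.range n, (2 * (A s ^ 2 * z s ^ 2) + 8 * η ^ 2) := by
          refine Finset.sum_le_sum fun s hs => ?_
          have h2 := hAB s (Finset.mem_range.1 hs)
          have h3 := hzB s (Finset.mem_range.1 hs)
          have h4 : (B s - A s) ^ 2 ≤ η ^ 2 := by rw [← sq_abs]; gcongr
          have h5 : z s ^ 2 ≤ 2 ^ 2 := by rw [← sq_abs]; gcongr
          have h6 : B s ^ 2 ≤ 2 * A s ^ 2 + 2 * (B s - A s) ^ 2 := by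
            nlinarith [sq_nonneg (2 * A s - B s)]
          have h7 := mul_le_mul_of_nonneg_right h6 (sq_nonneg (z s))
          have h8 := mul_le_mul h4 h5 (sq_nonneg _) (sq_nonneg _)
          rw [mul_pow]
          linarith
      _ = 2 * QA + 8 * (n * η ^ 2) := by
          rw [Finset.sum_add_distrib, ← Finset.mul_sum, Finset.sum_const, Finset.card_range,
            nsmul_eq_mul]
          ring
      _ ≤ 2 * QA + 8 * a ^ 2 := by
          have : n * η ^ 2 ≤ a ^ 2 := by
            calc n * η ^ 2 ≤ K * η ^ 2 := by gcongr
              _ ≤ K ^ 2 * η ^ 2 := by gcongr; nlinarith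
              _ = (K * η) ^ 2 := by ring
              _ ≤ a ^ 2 := by gcongr
          linarith
  have hsq : √((∑ s ∈ Finset.range n, (B s * z s) ^ 2) * Λ) ≤ √(2 * (QA * Λ)) + 3 * a * Λ := by
    calc _ ≤ √(2 * (QA * Λ) + (3 * a * Λ) ^ 2) := by
          refine Real.sqrt_le_sqrt ?_
          have h2 := mul_le_mul_of_nonneg_right hQ (by linarith : 0 ≤ Λ)
          nlinarith [mul_nonneg (mul_nonneg (sq_nonneg a) (by linarith : 0 ≤ Λ))
            (by linarith : 0 ≤ Λ - 1), sq_nonneg (a * Λ)]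
      _ ≤ √(2 * (QA * Λ)) + 3 * a * Λ := by
          refine Real.sqrt_le_iff.2 ⟨by positivity, ?_⟩
          rw [add_sq, Real.sq_sqrt (by positivity)]
          have : 0 ≤ 2 * √(2 * (QA * Λ)) * (3 * a * Λ) := by positivity
          linarith
  have hsq2 : 3 * √(2 * (QA * Λ)) ≤ √(QA * (128 * Λ)) := by
    refine Real.le_sqrt_of_sq_le ?_
    rw [mul_pow, Real.sq_sqrt (by positivity)]
    nlinarith [mul_nonneg hQA0 (by linarith : 0 ≤ Λ)]
  rw [hι]
  have : a ≤ a * Λ := le_mul_of_one_le_right ha0.le hΛ1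
  change |∑ s ∈ Finset.range n, A s * z s| ≤ √(QA * (128 * Λ)) + a * (128 * Λ)
  linarith

end

section

variable {d : ℕ} {Ω : Type*} [m0 : MeasurableSpace Ω] {P : Measure Ω} [IsProbabilityMeasure P]
  {x : ℕ → Ω → Vec d} {ε : ℕ → Ω → ℝ} {K : ℕ}

/-- Union bound of the self-normalized inequalities over the net, the levels, the tilts, the times
and the two signs. -/
lemma measure_exists_selfNormalized_gt_le {δ : ℝ} (hK : 0 < K) (h0 : 0 < δ)
    (hx : ∀ k < K, Measurable (x k))
    (hε : ∀ k < K, Measurable (ε k)) (hε2 : ∀ k < K, ∀ᵐ ω ∂P, |ε k ω| ≤ 2)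
    (hmean : ∀ k < K, P[ε k | history x ε k] =ᵐ[P] 0) {N : Finset (Vec d)}
    (hN : (N.card : ℝ) ≤ (1 + 4 / (1 / (K * 2 ^ numLevels d K))) ^ d) :
    P {ω | ¬ ∀ c ∈ N, ∀ ℓ ∈ Finset.Icc 1 (numLevels d K), ∀ j < K, ∀ n ∈ Finset.Icc 1 K,
      ∀ e ∈ ({1, -1} : Finset ℝ), ∑ s ∈ Finset.range n,
        (e / (4 * (2 : ℝ) ^ (-(ℓ : ℤ)) * 2 ^ j) * (clip ℓ (inner ℝ (x s ω) c) * ε s ω)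
          - (e / (4 * (2 : ℝ) ^ (-(ℓ : ℤ)) * 2 ^ j)) ^ 2
            * (clip ℓ (inner ℝ (x s ω) c) * ε s ω) ^ 2) ≤ iota d K δ / 128}
      ≤ ENNReal.ofReal δ := by
  set L := numLevels d K with hL
  set H : ℝ := 12 * (K : ℝ) * 2 ^ L with hH
  have hH1 : 1 ≤ H := one_le_width_base d hK
  set Λ := iota d K δ / 128 with hΛ
  let I : Finset (Vec d × ℕ × ℕ × ℕ × ℝ) :=
    N ×ˢ Finset.Icc 1 L ×ˢ Finset.range K ×ˢ Finset.Icc 1 K ×ˢ ({1, -1} : Finset ℝ)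
  let bad : Vec d × ℕ × ℕ × ℕ × ℝ → Set Ω := fun i =>
    {ω | Λ < ∑ s ∈ Finset.range i.2.2.2.1,
      (i.2.2.2.2 / (4 * (2 : ℝ) ^ (-(i.2.1 : ℤ)) * 2 ^ i.2.2.1)
          * (clip i.2.1 (inner ℝ (x s ω) i.1) * ε s ω)
        - (i.2.2.2.2 / (4 * (2 : ℝ) ^ (-(i.2.1 : ℤ)) * 2 ^ i.2.2.1)) ^ 2
          * (clip i.2.1 (inner ℝ (x s ω) i.1) * ε s ω) ^ 2)}
  have hbad : ∀ i ∈ I, P (bad i) ≤ ENNReal.ofReal (Real.exp (-Λ)) := by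
    rintro ⟨c, ℓ, j, n, e⟩ hi
    simp only [I, Finset.mem_product] at hi
    obtain ⟨_, _, _, hn, he⟩ := hi
    refine measure_selfNormalized_sum_le hx hε hε2 hmean c ℓ ?_ (Finset.mem_Icc.1 hn).2 Λ
    have he1 : |e| = 1 := by
      rcases Finset.mem_insert.1 he with rfl | he
      · norm_num
      · rw [Finset.mem_singleton.1 he]; norm_num
    have h2 : (1 : ℝ) ≤ 2 ^ j := one_le_pow₀ (by norm_num)
    have h3 : (0 : ℝ) < (2 : ℝ) ^ (-(ℓ : ℤ)) := by positivity
    dsimp only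
    rw [abs_div, he1, abs_of_pos (by positivity), div_mul_eq_mul_div, div_le_iff₀ (by positivity)]
    nlinarith
  have hexp : Real.exp (-Λ) = δ / H ^ (d + 2) := by
    have h2 : Λ = Real.log (H ^ (d + 2) / δ) := by rw [hΛ, iota]; ring
    rw [h2, ← Real.log_inv, Real.exp_log (by positivity), inv_div]
  have hcard : (I.card : ℝ) ≤ H ^ (d + 2) := by
    have hc : (I.card : ℝ) = N.card * (L * (K * (K * 2))) := by
      have h2 : (({1, -1} : Finset ℝ)).card = 2 := Finset.card_pair (by norm_num)
      simp only [I, Finset.card_product, h2, Nat.card_Icc, Finset.card_range]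
      push_cast; simp
    have hK1 : (1 : ℝ) ≤ K := by exact_mod_cast hK
    have hL1 : (L : ℝ) ≤ 2 ^ L := by exact_mod_cast Nat.lt_two_pow_self.le
    have h2L : (1 : ℝ) ≤ 2 ^ L := one_le_pow₀ (by norm_num)
    have h1 : (N.card : ℝ) ≤ H ^ d := by
      refine hN.trans (pow_le_pow_left₀ (by positivity) ?_ d)
      rw [div_div_eq_mul_div, div_one, hH]
      nlinarith
    have h2 : (L * (K * (K * 2)) : ℝ) ≤ H ^ 2 := by
      calc (L * (K * (K * 2)) : ℝ) ≤ 2 ^ L * (K * (K * 2)) := by gcongr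
        _ = 2 * K ^ 2 * 2 ^ L := by ring
        _ ≤ 144 * K ^ 2 * (2 ^ L) ^ 2 := by
            refine mul_le_mul (by nlinarith [sq_nonneg (K : ℝ)]) (by nlinarith) (by positivity)
              (by positivity)
        _ = H ^ 2 := by rw [hH]; ring
    rw [hc, pow_add]
    exact mul_le_mul h1 h2 (by positivity) (by positivity)
  calc _ ≤ P (⋃ i ∈ I, bad i) := by
        refine measure_mono fun ω hω => ?_
        simp only [Set.mem_ofPred_eq, not_forall, not_le] at hω
        obtain ⟨c, hc, ℓ, hℓ, j, hj, n, hn, e, he, hlt⟩ := hω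
        refine Set.mem_biUnion (x := (c, ℓ, j, n, e)) ?_ hlt
        simp only [I, Finset.coe_product, Set.mem_prod, Finset.mem_coe]
        exact ⟨hc, hℓ, Finset.mem_range.2 hj, hn, he⟩
    _ ≤ ∑ i ∈ I, P (bad i) := measure_biUnion_finset_le I bad
    _ ≤ ∑ _i ∈ I, ENNReal.ofReal (Real.exp (-Λ)) := Finset.sum_le_sum hbad
    _ = ENNReal.ofReal (I.card * (δ / H ^ (d + 2))) := by
        rw [Finset.sum_const, nsmul_eq_mul, hexp, ENNReal.ofReal_mul (by positivity),
          ENNReal.ofReal_natCast]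
    _ ≤ ENNReal.ofReal δ := by
        refine ENNReal.ofReal_le_ofReal ?_
        rw [mul_div_assoc', div_le_iff₀ (by positivity), mul_comm]
        gcongr

end

/-! ### Regret on the event that the confidence sets are valid -/

section Deterministic

variable {d : ℕ}

/-- Two parameters in the same confidence set are close in the truncated quadratic energy of their
difference. -/
lemma sum_clip_mul_le_of_mem_confLevel {K n ℓ : ℕ} {δ : ℝ} {x : ℕ → Vec d} {y : ℕ → ℝ}
    {θ θ' : Vec d} (hι : 0 ≤ iota d K δ) (hx : ∀ s < n, ‖x s‖ ≤ 1)
    (hθ : θ ∈ confLevel K δ x y n ℓ) (hθ' : θ' ∈ confLevel K δ x y n ℓ) {E : ℝ}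
    (hE : ∑ s ∈ Finset.range n, noiseResidual x y s θ' ^ 2 ≤ E) :
    ∑ s ∈ Finset.range n, clip ℓ (inner ℝ (x s) (θ - θ')) * inner ℝ (x s) (θ - θ')
      ≤ (2 : ℝ) ^ (-(ℓ : ℤ)) * (5 * √(E * iota d K δ) + 8 * iota d K δ) := by
  have hμ : ‖θ - θ'‖ ≤ 2 := by
    have := norm_sub_le θ θ'
    linarith [hθ.1, hθ'.1]
  have h1 := hθ.2 _ hμ
  have h2 := hθ'.2 _ hμ
  set ι := iota d K δ
  set a := (2 : ℝ) ^ (-(ℓ : ℤ)) with ha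
  have ha0 : 0 < a := by positivity
  set z : ℕ → ℝ := fun s => inner ℝ (x s) (θ - θ') with hz
  set u : ℕ → ℝ := fun s => noiseResidual x y s θ with hu
  set v : ℕ → ℝ := fun s => noiseResidual x y s θ' with hv
  change |∑ s ∈ Finset.range n, clip ℓ (z s) * u s| ≤
    √((∑ s ∈ Finset.range n, clip ℓ (z s) ^ 2 * u s ^ 2) * ι) + a * ι at h1
  change |∑ s ∈ Finset.range n, clip ℓ (z s) * v s| ≤
    √((∑ s ∈ Finset.range n, clip ℓ (z s) ^ 2 * v s ^ 2) * ι) + a * ι at h2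
  change ∑ s ∈ Finset.range n, v s ^ 2 ≤ E at hE
  change ∑ s ∈ Finset.range n, clip ℓ (z s) * z s ≤ a * (5 * √(E * ι) + 8 * ι)
  have hzuv : ∀ s, z s = v s - u s := fun s => by
    simp only [hz, hu, hv, noiseResidual, inner_sub_right]; ring
  set S := ∑ s ∈ Finset.range n, clip ℓ (z s) * z s with hS
  have hS0 : 0 ≤ S := Finset.sum_nonneg fun s _ => clip_mul_self_nonneg _ _
  have hE0 : 0 ≤ E := (Finset.sum_nonneg fun s _ => sq_nonneg _).trans hE
  have hSuv : S = ∑ s ∈ Finset.range n, clip ℓ (z s) * v s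
      - ∑ s ∈ Finset.range n, clip ℓ (z s) * u s := by
    rw [hS, ← Finset.sum_sub_distrib]
    refine Finset.sum_congr rfl fun s _ => ?_
    rw [← mul_sub, ← hzuv]
  have hcs : ∀ s, clip ℓ (z s) ^ 2 ≤ a ^ 2 := fun s => by
    rw [← sq_abs]
    have := abs_clip_le ℓ (z s)
    gcongr
  have hv2 : ∑ s ∈ Finset.range n, clip ℓ (z s) ^ 2 * v s ^ 2 ≤ a ^ 2 * E := by
    calc _ ≤ ∑ s ∈ Finset.range n, a ^ 2 * v s ^ 2 :=
          Finset.sum_le_sum fun s _ => mul_le_mul_of_nonneg_right (hcs s) (sq_nonneg _)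
      _ ≤ _ := by rw [← Finset.mul_sum]; gcongr
  have hu2 : ∑ s ∈ Finset.range n, clip ℓ (z s) ^ 2 * u s ^ 2 ≤ 2 * (a ^ 2 * E) + 4 * a * S := by
    calc _ ≤ ∑ s ∈ Finset.range n,
          (2 * (clip ℓ (z s) ^ 2 * v s ^ 2) + 4 * a * (clip ℓ (z s) * z s)) := by
          refine Finset.sum_le_sum fun s hs => ?_
          have hz2 : |z s| ≤ 2 := by
            refine (abs_real_inner_le_norm _ _).trans ?_
            have := hx s (Finset.mem_range.1 hs)
            nlinarith [norm_nonneg (x s), norm_nonneg (θ - θ')]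
          have h3 : u s ^ 2 ≤ 2 * v s ^ 2 + 2 * z s ^ 2 := by
            rw [hzuv s]; nlinarith [sq_nonneg (2 * v s - u s)]
          have h4 : clip ℓ (z s) ^ 2 * z s ^ 2 ≤ 2 * a * (clip ℓ (z s) * z s) := by
            have h5 : clip ℓ (z s) * z s ≤ a * 2 :=
              (le_abs_self _).trans (by
                rw [abs_mul]
                exact mul_le_mul (abs_clip_le _ _) hz2 (abs_nonneg _) ha0.le)
            have h6 := mul_le_mul_of_nonneg_right h5 (clip_mul_self_nonneg ℓ (z s))
            nlinarith
          have h7 := mul_le_mul_of_nonneg_left h3 (sq_nonneg (clip ℓ (z s)))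
          linarith
      _ = 2 * ∑ s ∈ Finset.range n, clip ℓ (z s) ^ 2 * v s ^ 2 + 4 * a * S := by
          rw [Finset.sum_add_distrib, ← Finset.mul_sum, ← Finset.mul_sum]
      _ ≤ _ := by linarith
  set w := √(E * ι) with hw
  have hw0 : 0 ≤ w := Real.sqrt_nonneg _
  have hw2 : w ^ 2 = E * ι := Real.sq_sqrt (by positivity)
  have hsv : √((∑ s ∈ Finset.range n, clip ℓ (z s) ^ 2 * v s ^ 2) * ι) ≤ a * w := by
    refine Real.sqrt_le_iff.2 ⟨by positivity, ?_⟩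
    rw [mul_pow, hw2, ← mul_assoc]
    gcongr
  -- The term in `S` is absorbed by `√(4 a S ι) ≤ S / 2 + 2 a ι`.
  have hsu : √((∑ s ∈ Finset.range n, clip ℓ (z s) ^ 2 * u s ^ 2) * ι)
      ≤ 3 / 2 * (a * w) + (S / 2 + 2 * a * ι) := by
    refine Real.sqrt_le_iff.2 ⟨by positivity, ?_⟩
    have h3 := mul_le_mul_of_nonneg_right hu2 hι
    have h4 : (a * w) ^ 2 = a ^ 2 * E * ι := by rw [mul_pow, hw2]; ring
    nlinarith [sq_nonneg (S / 2 - 2 * a * ι), sq_nonneg (a * w),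
      mul_nonneg (mul_nonneg ha0.le hw0) (by positivity : 0 ≤ S / 2 + 2 * a * ι)]
  have h3 := (abs_le.1 h1).1
  have h4 := (abs_le.1 h2).2
  linarith

/-- Number of rounds in which the optimistic parameter overestimates the played arm by more than
`2 ^ (-ℓ)`. -/
lemma card_overestimate_le {K ℓ : ℕ} {δ : ℝ} {x : ℕ → Vec d} {y : ℕ → ℝ} {θstar : Vec d}
    (hι : 1 ≤ iota d K δ) (hx : ∀ s < K, ‖x s‖ ≤ 1) (hℓ : ℓ ∈ Finset.Icc 1 (numLevels d K))
    (hstar : ∀ k < K, θstar ∈ confSet K δ x y k)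
    {θ : ℕ → Vec d} (hθ : ∀ k < K, θ k ∈ confSet K δ x y k) :
    (((Finset.range K).filter fun k =>
        (2 : ℝ) ^ (-(ℓ : ℤ)) < inner ℝ (x k) (θ k - θstar)).card : ℝ) * (2 : ℝ) ^ (-(ℓ : ℤ))
      ≤ 81 * d * (5 * √((∑ s ∈ Finset.range K, noiseResidual x y s θstar ^ 2) * iota d K δ)
          + 8 * iota d K δ) * Real.log (1 + 4 * K * (2 ^ numLevels d K) ^ 2) := by
  set a := (2 : ℝ) ^ (-(ℓ : ℤ)) with ha
  have ha0 : 0 < a := by positivity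
  have ha1 : a ≤ 1 := by
    rw [ha, zpow_neg, zpow_natCast]
    exact inv_le_one_of_one_le₀ (one_le_pow₀ (by norm_num))
  set E := ∑ s ∈ Finset.range K, noiseResidual x y s θstar ^ 2
  set B := 5 * √(E * iota d K δ) + 8 * iota d K δ with hB
  have hB1 : 1 ≤ B := by
    have := Real.sqrt_nonneg (E * iota d K δ)
    rw [hB]; linarith
  set G := (Finset.range K).filter fun k => a < inner ℝ (x k) (θ k - θstar) with hG
  have hμ : ∀ k < K, ‖θ k - θstar‖ ≤ 2 := fun k hk => by
    have h1 := (hθ k hk ℓ hℓ).1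
    have h2 := (hstar k hk ℓ hℓ).1
    have := norm_sub_le (θ k) θstar
    linarith
  have hcount := card_le_of_truncated_energy_le K G (Finset.filter_subset _ _) x
    (fun k => a⁻¹ • (θ k - θstar)) (M := B / a) (R := 2 / a)
    (by rw [le_div_iff₀ ha0]; linarith) (by positivity) hx
    (fun k hk => by
      have hk' := Finset.mem_range.1 (Finset.mem_filter.1 hk).1
      rw [norm_smul, norm_inv, Real.norm_of_nonneg ha0.le, inv_mul_eq_div]
      have := hμ k hk'
      gcongr)
    (fun k hk => by
      have := (Finset.mem_filter.1 hk).2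
      rw [inner_smul_right, inv_mul_eq_div, one_lt_div ha0]
      exact this)
    (fun k hk => by
      have hk' := Finset.mem_range.1 (Finset.mem_filter.1 hk).1
      have h1 := sum_clip_mul_le_of_mem_confLevel (E := E) (by linarith)
        (fun s hs => hx s (by omega)) (hθ k hk' ℓ hℓ) (hstar k hk' ℓ hℓ)
        (Finset.sum_le_sum_of_subset_of_nonneg (Finset.range_subset_range.2 hk'.le)
          fun s _ _ => sq_nonneg _)
      have h2 : ∑ s ∈ Finset.range k, min |inner ℝ (x s) (a⁻¹ • (θ k - θstar))| 1
          * |inner ℝ (x s) (a⁻¹ • (θ k - θstar))|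
          = (∑ s ∈ Finset.range k, clip ℓ (inner ℝ (x s) (θ k - θstar))
            * inner ℝ (x s) (θ k - θstar)) / a ^ 2 := by
        rw [Finset.sum_div]
        refine Finset.sum_congr rfl fun s _ => ?_
        rw [clip_mul_self, inner_smul_right, abs_mul, abs_of_pos (by positivity : 0 < a⁻¹), ← ha]
        have h3 : (1 : ℝ) = a⁻¹ * a := (inv_mul_cancel₀ ha0.ne').symm
        nth_rewrite 1 [h3]
        rw [← mul_min_of_nonneg _ _ (by positivity : 0 ≤ a⁻¹)]
        field_simp
      rw [h2, div_le_div_iff₀ (by positivity) ha0]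
      calc _ ≤ a * B * a := by gcongr
        _ = B * a ^ 2 := by ring)
  have hlog : Real.log (1 + K * (2 / a) ^ 2) ≤ Real.log (1 + 4 * K * (2 ^ numLevels d K) ^ 2) := by
    refine Real.log_le_log (by positivity) ?_
    have h1 : 2 / a = 2 * 2 ^ ℓ := by rw [ha, zpow_neg, zpow_natCast, div_inv_eq_mul]
    have h2 : (2 : ℝ) ^ ℓ ≤ 2 ^ numLevels d K :=
      pow_le_pow_right₀ (by norm_num) (Finset.mem_Icc.1 hℓ).2
    rw [h1]
    have h3 : ((2 : ℝ) ^ ℓ) ^ 2 ≤ (2 ^ numLevels d K) ^ 2 := by gcongr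
    have h4 : (0 : ℝ) ≤ K := by positivity
    nlinarith
  calc (G.card : ℝ) * a ≤ (81 * d * (B / a) * Real.log (1 + K * (2 / a) ^ 2)) * a := by gcongr
    _ = 81 * d * B * Real.log (1 + K * (2 / a) ^ 2) := by field_simp
    _ ≤ _ := by gcongr

/-- Dyadic peeling of a number that is at most `2`. -/
lemma le_sum_dyadic_indicator {z : ℝ} (hz : z ≤ 2) (L : ℕ) :
    z ≤ 2 * (2 : ℝ) ^ (-(L : ℤ)) + ∑ ℓ ∈ Finset.Icc 1 L,
      2 * ((2 : ℝ) ^ (-(ℓ : ℤ)) * if (2 : ℝ) ^ (-(ℓ : ℤ)) < z then 1 else 0) := by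
  induction L with
  | zero => simpa using hz
  | succ L ih =>
    have hsum : 0 ≤ ∑ ℓ ∈ Finset.Icc 1 L,
        2 * ((2 : ℝ) ^ (-(ℓ : ℤ)) * if (2 : ℝ) ^ (-(ℓ : ℤ)) < z then 1 else 0) :=
      Finset.sum_nonneg fun ℓ _ => by split_ifs <;> positivity
    have h2 : (2 : ℝ) ^ (-(L : ℤ)) = 2 * (2 : ℝ) ^ (-((L + 1 : ℕ) : ℤ)) := by
      push_cast
      rw [neg_add, zpow_add₀ (by norm_num)]; norm_num; ring
    rw [Finset.sum_Icc_succ_top (by omega)]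
    have hp : (0 : ℝ) < (2 : ℝ) ^ (-((L + 1 : ℕ) : ℤ)) := by positivity
    split_ifs with h
    · rw [h2] at ih; linarith
    · rw [not_lt] at h; linarith

/-- The cut-off level is fine enough for the rounds below it to contribute at most `2 d`. -/
lemma mul_two_zpow_neg_numLevels_le {d : ℕ} (hd : 1 ≤ d) (K : ℕ) :
    (K : ℝ) * (2 : ℝ) ^ (-(numLevels d K : ℤ)) ≤ 2 * d := by
  have hd0 : (0 : ℝ) < d := by exact_mod_cast hd
  have h1 : Real.logb 2 (1 + (K : ℝ) / d) < numLevels d K + 1 := by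
    refine (Nat.lt_floor_add_one _).trans_le ?_
    have : ⌊Real.logb 2 (1 + (K : ℝ) / (d : ℝ))⌋₊ ≤ numLevels d K := le_max_right _ _
    have : ((⌊Real.logb 2 (1 + (K : ℝ) / (d : ℝ))⌋₊ : ℕ) : ℝ) ≤ numLevels d K := by
      exact_mod_cast this
    linarith
  rw [Real.logb_lt_iff_lt_rpow (by norm_num) (by positivity)] at h1
  have h2 : (2 : ℝ) ^ ((numLevels d K : ℝ) + 1) = 2 ^ numLevels d K * 2 := by
    rw [Real.rpow_add (by norm_num), Real.rpow_natCast, Real.rpow_one]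
  rw [h2] at h1
  rw [zpow_neg, zpow_natCast, ← div_eq_mul_inv, div_le_iff₀ (by positivity)]
  have h3 : (K : ℝ) / d ≤ 2 ^ numLevels d K * 2 := by linarith
  rw [div_le_iff₀ hd0] at h3
  linarith

lemma two_pow_numLevels_le {d : ℕ} (hd : 1 ≤ d) (K : ℕ) :
    (2 : ℝ) ^ numLevels d K ≤ 2 * (1 + K) := by
  have hd1 : (1 : ℝ) ≤ d := by exact_mod_cast hd
  have hK : (0 : ℝ) ≤ K := by positivity
  have hx : (1 : ℝ) ≤ 1 + (K : ℝ) / d := by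
    have : 0 ≤ (K : ℝ) / d := by positivity
    linarith
  rw [numLevels]
  rcases max_choice 1 ⌊Real.logb 2 (1 + (K : ℝ) / (d : ℝ))⌋₊ with h | h
  · rw [h]; linarith
  · rw [h]
    have h1 : ((⌊Real.logb 2 (1 + (K : ℝ) / (d : ℝ))⌋₊ : ℕ) : ℝ)
        ≤ Real.logb 2 (1 + (K : ℝ) / d) := Nat.floor_le (Real.logb_nonneg (by norm_num) hx)
    have h2 := Real.rpow_le_rpow_of_exponent_le (by norm_num : (1 : ℝ) ≤ 2) h1
    rw [Real.rpow_logb (by norm_num) (by norm_num) (by positivity), Real.rpow_natCast] at h2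
    have h3 : (K : ℝ) / d ≤ K := div_le_self hK hd1
    linarith

/-- Regret bound in terms of the realized noise, when all confidence sets contain `θstar`. -/
lemma regret_le_of_mem_confSet {K : ℕ} {δ : ℝ} (hd : 1 ≤ d) (hι : 1 ≤ iota d K δ)
    {θstar : Vec d} {A : ℕ → Set (Vec d)} {x : ℕ → Vec d} {y : ℕ → ℝ}
    (hA : ∀ k < K, A k ⊆ Metric.closedBall 0 1) (hstar : ∀ k ≤ K, θstar ∈ confSet K δ x y k)
    (hchoice : ∀ k < K, IsVOFUL2Choice K δ (A k) x y k) :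
    regret K θstar A x ≤ 4 * d + numLevels d K * (162 * d *
      (5 * √((∑ s ∈ Finset.range K, noiseResidual x y s θstar ^ 2) * iota d K δ)
        + 8 * iota d K δ) * Real.log (1 + 4 * K * (2 ^ numLevels d K) ^ 2)) := by
  have hx : ∀ k < K, ‖x k‖ ≤ 1 := fun k hk => by
    simpa using hA k hk (hchoice k hk).1
  have hopt : ∀ k < K, θstar ∈ optimisticSet K δ x y k := fun k hk n hn => hstar n (by omega)
  have hex : ∀ k, ∃ θ : Vec d, k < K → θ ∈ optimisticSet K δ x y k ∧
      ∀ z ∈ A k, ∀ θ' ∈ optimisticSet K δ x y k, inner ℝ z θ' ≤ (inner ℝ (x k) θ : ℝ) := by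
    intro k
    by_cases hk : k < K
    · obtain ⟨θ, h1, h2⟩ := (hchoice k hk).2 ⟨θstar, hopt k hk⟩
      exact ⟨θ, fun _ => ⟨h1, h2⟩⟩
    · exact ⟨0, fun h => absurd h hk⟩
  choose θ hθ using hex
  have hθc : ∀ k < K, θ k ∈ confSet K δ x y k := fun k hk => (hθ k hk).1 k le_rfl
  set L := numLevels d K with hL
  set T := 81 * d *
      (5 * √((∑ s ∈ Finset.range K, noiseResidual x y s θstar ^ 2) * iota d K δ)
        + 8 * iota d K δ) * Real.log (1 + 4 * K * (2 ^ L) ^ 2) with hT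
  have hone : 1 ∈ Finset.Icc 1 L := Finset.mem_Icc.2 ⟨le_rfl, one_le_numLevels d K⟩
  have hround : ∀ k ∈ Finset.range K,
      sSup ((fun z : Vec d => (inner ℝ z θstar : ℝ)) '' A k) - inner ℝ (x k) θstar
        ≤ 2 * (2 : ℝ) ^ (-(L : ℤ)) + ∑ ℓ ∈ Finset.Icc 1 L, 2 * ((2 : ℝ) ^ (-(ℓ : ℤ)) *
          if (2 : ℝ) ^ (-(ℓ : ℤ)) < inner ℝ (x k) (θ k - θstar) then 1 else 0) := by
    intro k hk
    have hk := Finset.mem_range.1 hk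
    have h1 : sSup ((fun z : Vec d => (inner ℝ z θstar : ℝ)) '' A k) ≤ inner ℝ (x k) (θ k) := by
      refine csSup_le ⟨_, Set.mem_image_of_mem _ (hchoice k hk).1⟩ ?_
      rintro _ ⟨z, hz, rfl⟩
      exact (hθ k hk).2 z hz θstar (hopt k hk)
    have h2 : (inner ℝ (x k) (θ k - θstar) : ℝ) ≤ 2 := by
      refine (real_inner_le_norm _ _).trans ?_
      have h3 := (hθc k hk 1 hone).1
      have h4 := (hstar k hk.le 1 hone).1
      have h5 := norm_sub_le (θ k) θstar
      have h6 := hx k hk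
      nlinarith [norm_nonneg (x k), norm_nonneg (θ k - θstar)]
    refine le_trans ?_ (le_sum_dyadic_indicator h2 L)
    rw [inner_sub_right]
    linarith
  calc regret K θstar A x
      ≤ ∑ k ∈ Finset.range K, (2 * (2 : ℝ) ^ (-(L : ℤ)) + ∑ ℓ ∈ Finset.Icc 1 L,
          2 * ((2 : ℝ) ^ (-(ℓ : ℤ)) *
            if (2 : ℝ) ^ (-(ℓ : ℤ)) < inner ℝ (x k) (θ k - θstar) then 1 else 0)) :=
        Finset.sum_le_sum hround
    _ = 2 * (K * (2 : ℝ) ^ (-(L : ℤ))) + ∑ ℓ ∈ Finset.Icc 1 L,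
          2 * ((((Finset.range K).filter fun k =>
            (2 : ℝ) ^ (-(ℓ : ℤ)) < inner ℝ (x k) (θ k - θstar)).card : ℝ)
              * (2 : ℝ) ^ (-(ℓ : ℤ))) := by
        rw [Finset.sum_add_distrib, Finset.sum_comm, Finset.sum_const, Finset.card_range,
          nsmul_eq_mul]
        congr 1
        · ring
        · refine Finset.sum_congr rfl fun ℓ _ => ?_
          rw [← Finset.mul_sum, ← Finset.mul_sum, Finset.sum_boole, mul_comm (_ ^ _)]
    _ ≤ 2 * (2 * d) + ∑ ℓ ∈ Finset.Icc 1 L, 2 * T := by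
        refine add_le_add ?_ (Finset.sum_le_sum fun ℓ hℓ => ?_)
        · have := mul_two_zpow_neg_numLevels_le hd K
          linarith
        · have := card_overestimate_le hι hx hℓ (fun k hk => hstar k hk.le) hθc
          linarith
    _ = _ := by
        rw [Finset.sum_const, Nat.card_Icc, nsmul_eq_mul, hT]
        push_cast [Nat.add_sub_cancel]
        ring

end Deterministic

/-! ### The regret bound -/

/-- The arithmetic of the regret bound, once the level count, the confidence width and the counting
logarithm are bounded by multiples of one logarithm `t`. -/
lemma regret_bound_arith {d L ι lg t l s E : ℝ} (hd1 : 1 ≤ d) (ht1 : 1 ≤ t) (hl1 : 1 ≤ l)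
    (hs : 0 ≤ s) (hE : E ≤ 2 * s + 4 * l) (hL : L ≤ 3 * t) (hlg0 : 0 ≤ lg)
    (hlg : lg ≤ 6 * t) (hι0 : 0 ≤ ι) (hιup : ι ≤ 2048 * (d * t * l)) :
    4 * d + L * (162 * d * (5 * √(E * ι) + 8 * ι) * lg)
      ≤ 50000000 * t ^ 3 * (d ^ (3 / 2 : ℝ) * √(s * l) + d ^ 2 * l) := by
  have hl0 : 0 ≤ l := by linarith
  have ht0 : 0 ≤ t := by linarith
  set q := √(s * l) with hq
  have hq0 : 0 ≤ q := Real.sqrt_nonneg _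
  have hq2 : q ^ 2 = s * l := Real.sq_sqrt (by positivity)
  set rd := √d with hrd
  have hrd0 : 0 ≤ rd := Real.sqrt_nonneg _
  have hrd2 : rd ^ 2 = d := Real.sq_sqrt (by positivity)
  have hrdd : rd ≤ d := by
    rw [hrd, Real.sqrt_le_iff]; exact ⟨by positivity, by nlinarith⟩
  have h32 : d ^ (3 / 2 : ℝ) = d * rd := by
    rw [hrd, Real.sqrt_eq_rpow, show (3 / 2 : ℝ) = 1 + 1 / 2 by norm_num,
      Real.rpow_add (by linarith), Real.rpow_one]
  have hsqrt : √(E * ι) ≤ 64 * (rd * t * q) + 91 * (rd * t * l) := by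
    refine Real.sqrt_le_iff.2 ⟨by positivity, ?_⟩
    have h2 : E * ι ≤ (2 * s + 4 * l) * (2048 * (d * t * l)) :=
      (mul_le_mul_of_nonneg_right hE hι0).trans
        (mul_le_mul_of_nonneg_left hιup (by positivity))
    have h3 : (2 * s + 4 * l) * (2048 * (d * t * l))
        = 4096 * (d * t * (s * l)) + 8192 * (d * t * l ^ 2) := by ring
    have h4 : (64 * (rd * t * q) + 91 * (rd * t * l)) ^ 2
        = 4096 * (d * t ^ 2 * (s * l)) + 8281 * (d * t ^ 2 * l ^ 2)
          + 2 * (64 * (rd * t * q)) * (91 * (rd * t * l)) := by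
      rw [← hrd2, ← hq2]; ring
    have h5 : d * t * (s * l) ≤ d * t ^ 2 * (s * l) := by gcongr; exact le_self_pow₀ ht1 two_ne_zero
    have h6 : d * t * l ^ 2 ≤ d * t ^ 2 * l ^ 2 := by gcongr; exact le_self_pow₀ ht1 two_ne_zero
    have h7 : 0 ≤ 2 * (64 * (rd * t * q)) * (91 * (rd * t * l)) := by positivity
    have h8 : 0 ≤ d * t ^ 2 * l ^ 2 := by positivity
    linarith
  rw [h32]
  set R := d * rd * q + d ^ 2 * l with hR
  have hR0 : 0 ≤ R := by positivity
  have hB : d * (5 * √(E * ι) + 8 * ι) ≤ 17000 * (t * R) := by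
    have h2 : d * (5 * √(E * ι) + 8 * ι)
        ≤ d * (5 * (64 * (rd * t * q) + 91 * (rd * t * l)) + 8 * (2048 * (d * t * l))) := by
      gcongr
    have h3 : d * (rd * t * l) ≤ d * (d * t * l) := by gcongr
    have h4 : t * R = d * (rd * t * q) + d * (d * t * l) := by rw [hR]; ring
    have h5 : 0 ≤ d * (rd * t * q) := by positivity
    have h6 : 0 ≤ d * (d * t * l) := by positivity
    linarith
  have hd4 : (4 : ℝ) * d ≤ 4 * (t ^ 3 * R) := by
    have h2 : d ≤ R := by
      have : 0 ≤ d * rd * q := by positivity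
      have : d ≤ d ^ 2 * l :=
        (le_self_pow₀ hd1 two_ne_zero).trans (le_mul_of_one_le_right (by positivity) hl1)
      rw [hR]; linarith
    have h3 : 1 ≤ t ^ 3 := one_le_pow₀ ht1
    have h4 : R ≤ t ^ 3 * R := le_mul_of_one_le_left hR0 h3
    linarith
  have hmain : L * (162 * d * (5 * √(E * ι) + 8 * ι) * lg)
      ≤ (3 * t) * (162 * (17000 * (t * R)) * (6 * t)) := by
    rw [mul_assoc (162 : ℝ)]
    gcongr
  have h6 : (3 * t) * (162 * (17000 * (t * R)) * (6 * t)) = 49572000 * (t ^ 3 * R) := by ring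
  have h7 : 0 ≤ t ^ 3 * R := by positivity
  linarith

/-- Absorption of all logarithms into powers of `log T`, where `T` is the argument of the logarithm
in the regret bound. -/
lemma regret_bound_le_polylog {d K : ℕ} {δ s E : ℝ} (hd : 1 ≤ d) (hK : 0 < K) (h0 : 0 < δ)
    (h1 : δ ≤ Real.exp (-1)) (hs : 0 ≤ s) (hE : E ≤ 2 * s + 4 * Real.log (1 / δ)) :
    4 * d + numLevels d K * (162 * d * (5 * √(E * iota d K δ) + 8 * iota d K δ)
        * Real.log (1 + 4 * K * (2 ^ numLevels d K) ^ 2))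
      ≤ 50000000 * Real.log (Real.exp 1 + d + K + s + Real.log (1 / δ)) ^ 3
        * ((d : ℝ) ^ (3 / 2 : ℝ) * √(s * Real.log (1 / δ)) + (d : ℝ) ^ 2 * Real.log (1 / δ)) := by
  have hl1 := one_le_log_inv h0 h1
  have hι := iota_eq (d := d) hK h0
  have hιlow := log_inv_le_iota (d := d) hK h0
  have h2L := two_pow_numLevels_le hd K
  have hd1 : (1 : ℝ) ≤ d := by exact_mod_cast hd
  have hK1 : (1 : ℝ) ≤ K := by exact_mod_cast hK
  have hHbase := one_le_width_base d hK
  set L := numLevels d K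
  set ι := iota d K δ
  set l := Real.log (1 / δ)
  set T := Real.exp 1 + d + K + s + l with hT
  have he : 2 ≤ Real.exp 1 := by linarith [Real.add_one_le_exp 1]
  have hTK : K + 4 ≤ T := by rw [hT]; linarith
  have hTe : Real.exp 1 ≤ T := by rw [hT]; linarith
  have hT4 : 4 ≤ T := by linarith
  have hT0 : 0 < T := by linarith
  set t := Real.log T with ht
  have ht1 : 1 ≤ t := by
    rw [ht, Real.le_log_iff_exp_le hT0]; exact hTe
  have hpow : (0 : ℝ) < 2 ^ L := by positivity
  have hT2 : 16 ≤ T ^ 2 := by nlinarith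
  have hT3 : 64 ≤ T ^ 3 := by
    calc (64 : ℝ) = 4 ^ 3 := by norm_num
      _ ≤ T ^ 3 := by gcongr
  have hL : (L : ℝ) ≤ 3 * t := by
    have h2 : (2 : ℝ) ^ L ≤ T ^ 2 := by nlinarith
    have h3 := Real.log_le_log hpow h2
    rw [Real.log_pow, Real.log_pow] at h3
    push_cast at h3
    have h4 := Real.log_two_gt_d9
    have h5 : (0 : ℝ) ≤ L := by positivity
    have h6 := mul_le_mul_of_nonneg_left h4.le h5
    linarith
  have hlog : Real.log (1 + 4 * K * (2 ^ L) ^ 2) ≤ 6 * t := by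
    have h2 : 1 + 4 * K * (2 ^ L) ^ 2 ≤ T ^ 6 := by
      have h3 : ((2 : ℝ) ^ L) ^ 2 ≤ (2 * T) ^ 2 := by gcongr; linarith
      calc 1 + 4 * K * (2 ^ L) ^ 2 ≤ 1 + 4 * T * (2 * T) ^ 2 := by gcongr; linarith
        _ = 1 + 16 * T ^ 3 := by ring
        _ ≤ T ^ 3 + 16 * T ^ 3 := by linarith
        _ = 17 * T ^ 3 := by ring
        _ ≤ T ^ 3 * T ^ 3 := by gcongr; linarith
        _ = T ^ 6 := by ring
    have h3 := Real.log_le_log (by positivity) h2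
    rw [Real.log_pow] at h3
    exact_mod_cast h3
  have hιup : ι ≤ 2048 * (d * t * l) := by
    have h2 : 12 * (K : ℝ) * 2 ^ L ≤ T ^ 5 := by
      calc 12 * (K : ℝ) * 2 ^ L ≤ 12 * T * (2 * T) := by gcongr <;> linarith
        _ = 24 * T ^ 2 := by ring
        _ ≤ T ^ 3 * T ^ 2 := by gcongr; linarith
        _ = T ^ 5 := by ring
    have h3 := Real.log_le_log (by linarith) h2
    rw [Real.log_pow] at h3
    push_cast at h3
    have h4 : ((d : ℝ) + 2) * Real.log (12 * (K : ℝ) * 2 ^ L) ≤ (3 * d) * (5 * t) := by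
      refine mul_le_mul (by linarith) h3 (Real.log_nonneg hHbase) (by positivity)
    have h5 : d * t ≤ d * t * l := le_mul_of_one_le_right (by positivity) hl1
    have h6 : l ≤ d * t * l :=
      le_mul_of_one_le_left (by linarith) (one_le_mul_of_one_le_of_one_le hd1 ht1)
    rw [hι]
    linarith
  exact regret_bound_arith hd1 ht1 hl1 hs hE hL
    (Real.log_nonneg (le_add_of_nonneg_right (by positivity))) hlog (by linarith) hιup

theorem theorem1 :
    ∃ (C : ℝ) (p : ℕ), 0 < C ∧
      ∀ (d K : ℕ) (δ : ℝ), 1 ≤ d → 0 < δ → δ ≤ Real.exp (-1) →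
      ∀ (Ω : Type*) [MeasurableSpace Ω] (P : Measure Ω) [IsProbabilityMeasure P]
        (θstar : Vec d) (A : ℕ → Ω → Set (Vec d))
        (x : ℕ → Ω → Vec d) (ε r σ : ℕ → Ω → ℝ),
        ‖θstar‖ ≤ 1 →
        (∀ k < K, Measurable (x k)) →
        (∀ k < K, Measurable (ε k)) →
        (∀ k < K, ∀ ω, r k ω = inner ℝ (x k ω) θstar + ε k ω) →
        (∀ k < K, ∀ᵐ ω ∂P, A k ω ⊆ Metric.closedBall 0 1) →
        (∀ k < K, ∀ᵐ ω ∂P, |r k ω| ≤ 1) →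
        (∀ k < K, P[ε k | history x ε k] =ᵐ[P] 0) →
        (∀ k < K, P[fun ω => ε k ω ^ 2 | history x ε k] =ᵐ[P] fun ω => σ k ω ^ 2) →
        (∀ k < K, ∀ᵐ ω ∂P,
          IsVOFUL2Choice K δ (A k ω) (fun s => x s ω) (fun s => r s ω) k) →
        P {ω | ¬ regret K θstar (fun k => A k ω) (fun k => x k ω) ≤
            C * Real.log (Real.exp 1 + d + K + (∑ k ∈ Finset.range K, σ k ω ^ 2)
                  + Real.log (1 / δ)) ^ p
              * ((d : ℝ) ^ (3 / 2 : ℝ)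
                    * √((∑ k ∈ Finset.range K, σ k ω ^ 2) * Real.log (1 / δ))
                  + (d : ℝ) ^ 2 * Real.log (1 / δ))}
          ≤ ENNReal.ofReal (2 * δ) := by
  refine ⟨50000000, 3, by norm_num, ?_⟩
  intro d K δ hd h0 h1 Ω _ P _ θstar A x ε r σ hθ hx hε hr hA hr1 hmean hvar hchoice
  -- Without rounds the regret is `0`; `iota d 0 δ` involves `log 0`, so this case is separate.
  rcases Nat.eq_zero_or_pos K with rfl | hK
  · refine le_trans (le_of_eq ?_) zero_le
    convert measure_empty (μ := P)
    refine Set.eq_empty_of_forall_notMem fun ω hω => hω ?_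
    have hl := one_le_log_inv h0 h1
    have hlog : 0 ≤ Real.log (Real.exp 1 + d + (0 : ℕ) + (∑ k ∈ Finset.range 0, σ k ω ^ 2)
        + Real.log (1 / δ)) := by
      refine Real.log_nonneg ?_
      have h2 := Real.exp_pos 1
      have h3 : (0 : ℝ) ≤ d := by positivity
      simp only [Finset.range_zero, Finset.sum_empty, Nat.cast_zero]
      linarith
    rw [regret, Finset.range_zero, Finset.sum_empty]
    rw [Finset.range_zero] at hlog
    positivity
  have hxn : ∀ᵐ ω ∂P, ∀ k ∈ Finset.range K, ‖x k ω‖ ≤ 1 := by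
    refine (Finset.eventually_all _).2 fun k hk => ?_
    filter_upwards [hA k (Finset.mem_range.1 hk), hchoice k (Finset.mem_range.1 hk)] with ω h2 h3
    simpa using h2 h3.1
  have hε2 : ∀ k < K, ∀ᵐ ω ∂P, |ε k ω| ≤ 2 := by
    intro k hk
    filter_upwards [hxn, hr1 k hk] with ω h2 h3
    have h4 := h2 k (Finset.mem_range.2 hk)
    have h5 := abs_real_inner_le_norm (x k ω) θstar
    have h6 : ‖x k ω‖ * ‖θstar‖ ≤ 1 := mul_le_one₀ h4 (norm_nonneg _) hθ
    have h7 : ε k ω = r k ω - inner ℝ (x k ω) θstar := by rw [hr k hk ω]; ring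
    rw [h7]
    exact (abs_sub _ _).trans (by linarith)
  obtain ⟨N, hNcard, hN⟩ := exists_net_ball_two d
    (η := 1 / (K * 2 ^ numLevels d K)) (by positivity)
  have hbad1 := measure_exists_selfNormalized_gt_le hK h0 hx hε hε2 hmean hNcard
  have hbad2 := measure_sum_sq_noise_gt_le hx hε hε2 hvar (Real.log (1 / δ))
  rw [one_div, Real.log_inv, neg_neg, Real.exp_log h0, ← Real.log_inv, ← one_div] at hbad2
  rw [two_mul, ENNReal.ofReal_add h0.le h0.le]
  refine le_trans (le_trans (measure_mono_ae ?_) (measure_union_le _ _)) (add_le_add hbad1 hbad2)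
  have hε2' : ∀ᵐ ω ∂P, ∀ k ∈ Finset.range K, |ε k ω| ≤ 2 :=
    (Finset.eventually_all _).2 fun k hk => hε2 k (Finset.mem_range.1 hk)
  have hA' : ∀ᵐ ω ∂P, ∀ k ∈ Finset.range K, A k ω ⊆ Metric.closedBall 0 1 :=
    (Finset.eventually_all _).2 fun k hk => hA k (Finset.mem_range.1 hk)
  have hchoice' : ∀ᵐ ω ∂P, ∀ k ∈ Finset.range K,
      IsVOFUL2Choice K δ (A k ω) (fun s => x s ω) (fun s => r s ω) k :=
    (Finset.eventually_all _).2 fun k hk => hchoice k (Finset.mem_range.1 hk)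
  filter_upwards [hxn, hε2', hA', hchoice'] with ω hxω hεω hAω hcω hω
  by_contra hgood
  refine hω ?_
  obtain ⟨hg1, hg2⟩ := not_or.1 hgood
  replace hg1 := not_not.1 hg1
  replace hg2 := not_lt.1 (Set.notMem_ofPred_iff.1 hg2)
  have hres : ∀ s < K, noiseResidual (fun s => x s ω) (fun s => r s ω) s θstar = ε s ω :=
    fun s hs => by simp only [noiseResidual, hr s hs ω]; ring
  have hιl := log_inv_le_iota (d := d) hK h0
  have hl := one_le_log_inv h0 h1
  have hconf : ∀ n ≤ K, θstar ∈ confSet K δ (fun s => x s ω) (fun s => r s ω) n := by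
    intro n hn
    refine mem_confSet_of_net hK h0 h1 hθ (fun s hs => hxω s (Finset.mem_range.2 hs))
      (fun s hs => by rw [hres s hs]; exact hεω s (Finset.mem_range.2 hs)) hN ?_ hn
    intro c hc ℓ hℓ j hj n hn e he
    rcases Nat.eq_zero_or_pos n with rfl | hn0
    · rw [Finset.range_zero, Finset.sum_empty]; linarith
    refine le_trans (le_of_eq (Finset.sum_congr rfl fun s hs => ?_))
      (hg1 c hc ℓ hℓ j hj n (Finset.mem_Icc.2 ⟨hn0, hn⟩) e he)
    rw [hres s ((Finset.mem_range.1 hs).trans_le hn)]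
  refine (regret_le_of_mem_confSet hd (by linarith)
    (fun k hk => hAω k (Finset.mem_range.2 hk)) hconf
    (fun k hk => hcω k (Finset.mem_range.2 hk))).trans ?_
  refine regret_bound_le_polylog hd hK h0 h1 (Finset.sum_nonneg fun k _ => sq_nonneg _) ?_
  rw [Finset.sum_congr rfl fun s hs => by rw [hres s (Finset.mem_range.1 hs)]]
  exact hg2
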